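/- Let $a,b$ be integers with $2\le a\le b$, let $p>0$ be real, and let $q$ be an even integer with $2\le q\le a$. Set $$f(x,y)=x^ay^b+x^{a-q}y^b e^{-1/|y|^p}\qquad((x,y)\in\mathbb R^2),$$ where $e^{-1/|y|^p}$ is read as $0$ at $y=0$. Let $\varphi:\mathbb R^2\to\mathbb R$ be a $C^\infty$ function with compact support. The integral $$Z_f(\varphi)(s)=\int_{\mathbb R^2}|f(x,y)|^s\varphi(x,y)\,dx\,dy$$ converges absolutely for $\mathrm{Re}(s)>0$, and $Z_f(\varphi)$ continues to a meromorphic function, again denoted $Z_f(\varphi)$, on the half-plane $\mathrm{Re}(s)>-1/a$, whose poles are contained in $\{-j/b : j\in\mathbb Z,\ j\ge 1,\ j<b/a\}$. Moreover, the improper integrals $$C=\int_0^\infty u^{-b/a-p}e^{-1/(qu^p)}\,du,\qquad \tilde C=\int_0^\infty u^{-p-1}e^{-1/(qu^p)}\,du$$ converge and are positive, and the following hold, where $\sigma$ is real. (i) If $p<b/a-1$, or if $b/a$ is not an odd integer, then $$\lim_{\sigma\to-1/a+0}(a\sigma+1)^{1+\frac{b/a-1}{p}}\,Z_f(\varphi)(\sigma)=\frac{-4pC}{q(b/a-1)}\,\varphi(0,0).$$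 (ii) If $p=b/a-1$ and $b/a$ is an odd integer (so that $p$ is a positive integer), then $$\lim_{\sigma\to-1/a+0}(a\sigma+1)^{2}\,Z_f(\varphi)(\sigma)=\frac{-4C}{q}\,\varphi(0,0)+\frac{4a\tilde C}{bq\,(p-1)!}\,\frac{\partial^p\varphi}{\partial y^p}(0,0).$$ (iii) If $p>b/a-1$ and $b/a$ is an odd integer, then, with $m=b/a-1$, $$\lim_{\sigma\to-1/a+0}(a\sigma+1)^{2}\,Z_f(\varphi)(\sigma)=\frac{4ap\tilde C}{bq\,m!}\,\frac{\partial^m\varphi}{\partial y^m}(0,0).$$ -/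

import Mathlib

open Set Filter Topology MeasureTheory
open scoped ContDiff

/-- The flat smooth function `e^{-1/|y|^p}` on the real line, with value `0` at `y = 0`. -/
noncomputable def flatExp (p y : ℝ) : ℝ :=
  if y = 0 then 0 else Real.exp (-1 / |y| ^ p)

/-- `f(x,y) = x^a y^b + x^(a-q) y^b e^{-1/|y|^p}`; it is only used with `q ≤ a`. -/
noncomputable def modelFun (a b q : ℕ) (p : ℝ) (z : ℝ × ℝ) : ℝ :=
  z.1 ^ a * z.2 ^ b + z.1 ^ (a - q) * z.2 ^ b * flatExp p z.2

/-- The integrand `|f(x,y)|^s φ(x,y)` of the local zeta function. -/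
noncomputable def zetaIntegrand (f φ : ℝ × ℝ → ℝ) (s : ℂ) (z : ℝ × ℝ) : ℂ :=
  ((|f z| : ℝ) : ℂ) ^ s * ((φ z : ℝ) : ℂ)

/-- The integral `Z_f(φ)(s) = ∫_{ℝ²} |f(x,y)|^s φ(x,y) dx dy`. -/
noncomputable def localZeta (f φ : ℝ × ℝ → ℝ) (s : ℂ) : ℂ :=
  ∫ z : ℝ × ℝ, zetaIntegrand f φ s z

/-- `F` is a meromorphic continuation of `Z_f(φ)` to the half-plane `Re s > c`, all of whose
poles lie in `P`: the integral converges for `Re s > 0` and `F` agrees with it there, `F` is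
meromorphic on the half-plane and holomorphic at every point of it outside `P`. -/
structure IsZetaContinuation (f φ : ℝ × ℝ → ℝ) (c : ℝ) (P : Set ℂ) (F : ℂ → ℂ) : Prop where
  integrable : ∀ s : ℂ, 0 < s.re → Integrable (zetaIntegrand f φ s)
  eq_integral : ∀ s : ℂ, 0 < s.re → F s = localZeta f φ s
  meromorphic : MeromorphicOn F {s : ℂ | c < s.re}
  analytic : AnalyticOnNhd ℂ F ({s : ℂ | c < s.re} \ P)

/-- The candidate poles `-j/b` with `j ≥ 1` an integer and `j < b/a`. -/
def candidatePoles (a b : ℕ) : Set ℂ :=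
  {s : ℂ | ∃ j : ℕ, 1 ≤ j ∧ (j : ℝ) < (b : ℝ) / a ∧ s = -(j : ℂ) / (b : ℂ)}

/-- The integrand `u^{-b/a-p} e^{-1/(q u^p)}` of the constant `C`. -/
noncomputable def integrandC (a b q : ℕ) (p u : ℝ) : ℝ :=
  u ^ (-((b : ℝ) / a) - p) * Real.exp (-1 / ((q : ℝ) * u ^ p))

/-- `C = ∫_0^∞ u^{-b/a-p} e^{-1/(q u^p)} du`. -/
noncomputable def constC (a b q : ℕ) (p : ℝ) : ℝ :=
  ∫ u in Ioi (0 : ℝ), integrandC a b q p u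

/-- The integrand `u^{-p-1} e^{-1/(q u^p)}` of the constant `C̃`. -/
noncomputable def integrandCtilde (q : ℕ) (p u : ℝ) : ℝ :=
  u ^ (-p - 1) * Real.exp (-1 / ((q : ℝ) * u ^ p))

/-- `C̃ = ∫_0^∞ u^{-p-1} e^{-1/(q u^p)} du`. -/
noncomputable def constCtilde (q : ℕ) (p : ℝ) : ℝ :=
  ∫ u in Ioi (0 : ℝ), integrandCtilde q p u

/-- The real number `r` is an odd integer. -/
def IsOddInteger (r : ℝ) : Prop := ∃ k : ℤ, Odd k ∧ r = (k : ℝ)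

/-- `∂^m φ / ∂y^m` at the origin. -/
noncomputable def dyOrigin (φ : ℝ × ℝ → ℝ) (m : ℕ) : ℝ :=
  iteratedDeriv m (fun y : ℝ => φ (0, y)) 0

/-! Write β = b/a. Since q is even, |f| is invariant under both reflections, so the integral folds
to the open quadrant with φ replaced by ψ = `reflectSum φ` (`localZeta_modelFun_eq`). There f = x^a
y^b (1 + (E/x)^q) with E(y) = e^{-1/(q y^p)}, and f^s is split as (x^a y^b)^s plus a difference.

The monomial part is a Mellin integral. Integrating by parts n times in y, where n < β ≤ n + 1,
produces the factors 1/(bs + j), 1 ≤ j ≤ n, and an integral that converges for Re s > -1/a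
(`quadMellin_eq_partialSnd_iterate`). These factors account for all the candidate poles.

The difference is holomorphic on the whole half-plane (`differentiableAt_perturbIntegral`). At real
s = (ε - 1)/a it depends on x only through x^{-1+ε} and x/E. The substitution V = (x/E)^ε turns the
x-integral into E^ε/ε times an average of ψ against `scaleKernel`, and the flat factor E^ε absorbs
every negative power of y.

Let ε = aσ + 1 → 0+. The kernel tends to the indicator of (0,1) and the average to ψ(0,0) = 4φ(0,0).
Rescaling y = ε^{1/p} u shows that, for β > 1, the difference behaves like -ε^{-1-(β-1)/p} ψ(0,0) ∫
u^{-β} e^{-1/(q u^p)} du (`tendsto_rpow_mul_perturbIntegral`). The monomial part is at most of order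
ε^{-2}. That order comes from β = n + 1, with coefficient ∂_y^n ψ(0,0)/(β n!); this vanishes for odd
n, since ψ is even in y, and equals 4 ∂_y^n φ(0,0)/(β n!) for even n. The three cases compare the
orders 1 + (β-1)/p and 2. -/

/-! ### Folding the plane onto the quadrant. -/

/-- Lebesgue measure on the open first quadrant. -/
noncomputable def quadMeasure : Measure (ℝ × ℝ) :=
  (volume.restrict (Ioi (0 : ℝ))).prod (volume.restrict (Ioi (0 : ℝ)))

lemma ae_quadMeasure : ∀ᵐ z ∂quadMeasure, 0 < z.1 ∧ 0 < z.2 := by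
  rw [quadMeasure, Measure.prod_restrict]
  exact ae_restrict_mem (measurableSet_Ioi.prod measurableSet_Ioi)

lemma quadMeasure_le : quadMeasure ≤ volume := by
  rw [quadMeasure, Measure.prod_restrict]
  exact Measure.restrict_le_self

lemma integral_eq_integral_Ioi_add_comp_neg {g : ℝ → ℂ} (hg : Integrable g) :
    ∫ x, g x = ∫ x in Ioi (0 : ℝ), (g x + g (-x)) := by
  rw [integral_add hg.integrableOn hg.comp_neg.integrableOn, integral_comp_neg_Ioi, neg_zero,
    ← integral_add_compl (measurableSet_Ioi (a := (0 : ℝ))) hg, compl_Ioi]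

lemma integral_eq_integral_quadrant {H : ℝ × ℝ → ℂ} (hH : Integrable H) :
    ∫ z, H z = ∫ z, (H (z.1, z.2) + H (z.1, -z.2) + (H (-z.1, z.2) + H (-z.1, -z.2)))
      ∂quadMeasure := by
  have h1 : MeasurePreserving (fun z : ℝ × ℝ => (z.1, -z.2)) volume volume :=
    (MeasurePreserving.id volume).prod (Measure.measurePreserving_neg volume)
  have h2 : MeasurePreserving (fun z : ℝ × ℝ => (-z.1, z.2)) volume volume :=
    (Measure.measurePreserving_neg volume).prod (MeasurePreserving.id volume)
  have h3 : MeasurePreserving (fun z : ℝ × ℝ => (-z.1, -z.2)) volume volume :=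
    (Measure.measurePreserving_neg volume).prod (Measure.measurePreserving_neg volume)
  have e1 : Integrable fun z : ℝ × ℝ => H (z.1, -z.2) := h1.integrable_comp_of_integrable hH
  have e2 : Integrable fun z : ℝ × ℝ => H (-z.1, z.2) := h2.integrable_comp_of_integrable hH
  have e3 : Integrable fun z : ℝ × ℝ => H (-z.1, -z.2) := h3.integrable_comp_of_integrable hH
  have e0 : Integrable fun z : ℝ × ℝ => H (z.1, z.2) := hH
  have hS := (e0.add e1).add (e2.add e3)
  have hQ : Integrable (fun z : ℝ × ℝ => H (z.1, z.2) + H (z.1, -z.2) +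
      (H (-z.1, z.2) + H (-z.1, -z.2))) quadMeasure := hS.mono_measure quadMeasure_le
  have step : ∫ z, H z = ∫ x, ∫ y in Ioi (0 : ℝ), (H (x, y) + H (x, -y)) := by
    rw [Measure.volume_eq_prod, integral_prod _ hH]
    refine integral_congr_ae ?_
    filter_upwards [hH.prod_right_ae] with x hx
    exact integral_eq_integral_Ioi_add_comp_neg hx
  have hP : Integrable (fun z : ℝ × ℝ => H (z.1, z.2) + H (z.1, -z.2))
      (volume.prod (volume.restrict (Ioi (0 : ℝ)))) := by
    refine (e0.add e1).mono_measure ?_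
    have h : (volume : Measure ℝ).prod (volume.restrict (Ioi (0 : ℝ)))
        = (volume.prod volume).restrict (univ ×ˢ Ioi (0 : ℝ)) := by
      rw [← Measure.prod_restrict, Measure.restrict_univ]
    rw [h]
    exact Measure.restrict_le_self
  rw [quadMeasure] at hQ ⊢
  rw [step, integral_eq_integral_Ioi_add_comp_neg hP.integral_prod_left, integral_prod _ hQ]
  refine integral_congr_ae ?_
  have hP1 := hP.prod_right_ae
  have hP2 : ∀ᵐ x : ℝ, Integrable (fun y => H (-x, y) + H (-x, -y))
      (volume.restrict (Ioi (0 : ℝ))) :=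
    (Measure.measurePreserving_neg (volume : Measure ℝ)).quasiMeasurePreserving.ae hP1
  filter_upwards [ae_restrict_of_ae hP1, ae_restrict_of_ae hP2] with x hx1 hx2
  exact (integral_add hx1 hx2).symm

/-! ### Holomorphic dependence on a parameter. -/

/-- An integral depending holomorphically on a parameter, with local domination only on the
integrand itself. -/
lemma differentiableAt_integral_of_dominated {α : Type*} [MeasurableSpace α] {μ : Measure α}
    {F : ℂ → α → ℂ} {s₀ : ℂ} {r : ℝ} (hr : 0 < r) {B : α → ℝ}
    (hmeas : ∀ s, AEStronglyMeasurable (F s) μ)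
    (hdiff : ∀ᵐ z ∂μ, Differentiable ℂ fun s => F s z)
    (hB : ∀ᵐ z ∂μ, ∀ s ∈ Metric.ball s₀ r, ‖F s z‖ ≤ B z) (hBi : Integrable B μ) :
    DifferentiableAt ℂ (fun s => ∫ z, F s z ∂μ) s₀ := by
  have hr3 : 0 < r / 3 := by positivity
  -- The derivative is measurable as an a.e. limit of difference quotients along s₀ + 1/(n+1).
  have hF' : AEStronglyMeasurable (fun z => deriv (fun s => F s z) s₀) μ := by
    have hv : Tendsto (fun n : ℕ => s₀ + ((n : ℂ) + 1)⁻¹) atTop (𝓝[≠] s₀) := by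
      refine tendsto_nhdsWithin_iff.2 ⟨?_, Eventually.of_forall fun n => ?_⟩
      · have := tendsto_one_div_add_atTop_nhds_zero_nat (𝕜 := ℂ)
        simpa using this.const_add s₀
      · have : ((n : ℂ) + 1) ≠ 0 := by exact_mod_cast Nat.succ_ne_zero n
        simp [this]
    refine aestronglyMeasurable_of_tendsto_ae (u := atTop)
      (f := fun (n : ℕ) z => slope (fun s => F s z) s₀ (s₀ + ((n : ℂ) + 1)⁻¹)) (fun n => ?_) ?_
    · simp only [slope, vsub_eq_sub]
      exact ((hmeas _).sub (hmeas s₀)).const_smul (s₀ + ((n : ℂ) + 1)⁻¹ - s₀)⁻¹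
    · filter_upwards [hdiff] with z hz
      exact (hasDerivAt_iff_tendsto_slope.1 (hz s₀).hasDerivAt).comp hv
  refine (hasDerivAt_integral_of_dominated_loc_of_deriv_le (bound := fun z => B z / (r / 3))
    (F' := fun s z => deriv (fun s => F s z) s) (Metric.ball_mem_nhds s₀ hr3)
    (Eventually.of_forall hmeas) ?_ hF' ?_ (hBi.div_const _) ?_).2.differentiableAt
  · refine hBi.mono' (hmeas _) ?_
    filter_upwards [hB] with z hz
    exact hz s₀ (Metric.mem_ball_self hr)
  · filter_upwards [hB, hdiff] with z hz hd s hs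
    -- Cauchy's estimate on a circle of radius r/3 about s; as s is within r/3 of s₀, the circle
    -- stays inside the ball where `B` dominates.
    refine Complex.norm_deriv_le_of_forall_mem_sphere_norm_le hr3 hd.diffContOnCl fun w hw => ?_
    refine hz w ?_
    rw [Metric.mem_ball] at hs ⊢
    rw [mem_sphere_iff_norm, ← dist_eq_norm] at hw
    linarith [dist_triangle w s s₀]
  · filter_upwards [hdiff] with z hz s _
    exact (hz s).hasDerivAt

/-! ### The constants C and C̃ as Gamma integrals. -/

/-- The inversion u ↦ 1/u, Jacobian included, carries these integrands to v^{-r-2} e^{-v^p/c}, whose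
integral is a Gamma value. -/
lemma rpow_mul_exp_neg_comp_inv {p r c u : ℝ} (hu : 0 < u) :
    (|(-1 : ℝ)| * u ^ ((-1 : ℝ) - 1)) • ((u ^ (-1 : ℝ)) ^ (-r - 2) *
      Real.exp (-(1 / c) * (u ^ (-1 : ℝ)) ^ p)) = u ^ r * Real.exp (-1 / (c * u ^ p)) := by
  rw [← Real.rpow_mul hu.le, ← Real.rpow_mul hu.le, smul_eq_mul, ← mul_assoc, abs_neg, abs_one,
    one_mul, ← Real.rpow_add hu, neg_one_mul p, Real.rpow_neg hu.le]
  congr 1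
  · congr 1; ring
  · congr 1; rw [neg_div, one_div, neg_mul, one_div, mul_inv]

lemma integrableOn_rpow_mul_exp_neg_inv {p r c : ℝ} (hp : 0 < p) (hr : r < -1) (hc : 0 < c) :
    IntegrableOn (fun u => u ^ r * Real.exp (-1 / (c * u ^ p))) (Ioi 0) := by
  have h := integrableOn_rpow_mul_exp_neg_mul_rpow (p := p) (s := -r - 2) (b := 1 / c)
    (by linarith) hp (by positivity)
  rw [← integrableOn_Ioi_comp_rpow_iff _ (by norm_num : (-1 : ℝ) ≠ 0)] at h
  exact h.congr_fun (fun u hu => rpow_mul_exp_neg_comp_inv hu) measurableSet_Ioi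

lemma integral_rpow_mul_exp_neg_inv {p r c : ℝ} (hp : 0 < p) (hr : r < -1) (hc : 0 < c) :
    ∫ u in Ioi (0 : ℝ), u ^ r * Real.exp (-1 / (c * u ^ p)) =
      c ^ ((-r - 1) / p) * (1 / p) * Real.Gamma ((-r - 1) / p) := by
  have h := integral_rpow_mul_exp_neg_mul_rpow (p := p) (q := -r - 2) (b := 1 / c) hp
    (by linarith) (by positivity)
  rw [← integral_comp_rpow_Ioi _ (by norm_num : (-1 : ℝ) ≠ 0)] at h
  rw [setIntegral_congr_fun measurableSet_Ioi
    (fun u hu => rpow_mul_exp_neg_comp_inv (p := p) (r := r) (c := c) hu)] at h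
  rw [h, one_div, Real.inv_rpow hc.le, ← Real.rpow_neg hc.le]
  congr 2
  · congr 1; ring_nf
  · ring

lemma constCtilde_eq {q : ℕ} {p : ℝ} (hp : 0 < p) (hq : 0 < q) : constCtilde q p = q / p := by
  have hq' : (0 : ℝ) < q := by exact_mod_cast hq
  unfold constCtilde integrandCtilde
  rw [integral_rpow_mul_exp_neg_inv hp (by linarith) hq']
  have : (-(-p - 1) - 1) / p = 1 := by field_simp; ring
  rw [this, Real.rpow_one, Real.Gamma_one]; ring

lemma constC_pos {a b q : ℕ} {p : ℝ} (hp : 0 < p) (hq : 0 < q) (hab : 1 ≤ (b : ℝ) / a) :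
    0 < constC a b q p := by
  have hq' : (0 : ℝ) < q := by exact_mod_cast hq
  unfold constC integrandC
  rw [integral_rpow_mul_exp_neg_inv hp (by linarith) hq']
  have : 0 < (-(-((b : ℝ) / a) - p) - 1) / p := by
    apply div_pos _ hp; linarith
  have := Real.Gamma_pos_of_pos this
  positivity

/-- Rescaling the difference term produces the integral on the left; Γ(z+1) = zΓ(z) at z = (β-1)/p
converts it to C. -/
lemma integral_rpow_mul_exp_eq_constC {a b q : ℕ} {p : ℝ} (hp : 0 < p) (hq : 0 < q)
    (hab : 1 < (b : ℝ) / a) :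
    ∫ u in Ioi (0 : ℝ), u ^ (-((b : ℝ) / a)) * Real.exp (-1 / (q * u ^ p)) =
      p * constC a b q p / (q * ((b : ℝ) / a - 1)) := by
  have hq' : (0 : ℝ) < q := by exact_mod_cast hq
  unfold constC integrandC
  rw [integral_rpow_mul_exp_neg_inv hp (by linarith) hq',
    integral_rpow_mul_exp_neg_inv hp (by linarith) hq']
  set β := (b : ℝ) / a
  have hβ : 0 < β - 1 := by linarith
  have h1 : (-(-β - p) - 1) / p = (β - 1) / p + 1 := by field_simp; ring
  have h2 : (-(-β) - 1) / p = (β - 1) / p := by ring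
  rw [h1, h2, Real.Gamma_add_one (by positivity), Real.rpow_add hq', Real.rpow_one]
  field_simp

/-! ### Derivatives in y and symmetrization. -/

/-- The partial derivative in the second variable. -/
noncomputable def partialSnd (g : ℝ × ℝ → ℝ) (z : ℝ × ℝ) : ℝ := fderiv ℝ g z (0, 1)

lemma ContDiff.partialSnd {g : ℝ × ℝ → ℝ} (hg : ContDiff ℝ ∞ g) : ContDiff ℝ ∞ (partialSnd g) :=
  (hg.fderiv_right (m := ∞) (by simp)).clm_apply contDiff_const

lemma HasCompactSupport.partialSnd {g : ℝ × ℝ → ℝ} (hg : HasCompactSupport g) :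
    HasCompactSupport (partialSnd g) :=
  hg.fderiv_apply ℝ (0, 1)

lemma hasDerivAt_partialSnd {g : ℝ × ℝ → ℝ} (hg : ContDiff ℝ ∞ g) (x y : ℝ) :
    HasDerivAt (fun y => g (x, y)) (partialSnd g (x, y)) y := by
  have h1 : HasFDerivAt g (fderiv ℝ g (x, y)) (x, y) :=
    (hg.differentiable (by simp) (x, y)).hasFDerivAt
  have h2 : HasDerivAt (fun y : ℝ => (x, y)) ((0, 1) : ℝ × ℝ) y :=
    (hasDerivAt_const y x).prodMk (hasDerivAt_id y)
  exact h1.comp_hasDerivAt y h2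

lemma contDiff_partialSnd_iterate {g : ℝ × ℝ → ℝ} (hg : ContDiff ℝ ∞ g) (n : ℕ) :
    ContDiff ℝ ∞ (partialSnd^[n] g) := by
  induction n with
  | zero => exact hg
  | succ n ih => rw [Function.iterate_succ_apply']; exact ih.partialSnd

lemma hasCompactSupport_partialSnd_iterate {g : ℝ × ℝ → ℝ} (hg : HasCompactSupport g) (n : ℕ) :
    HasCompactSupport (partialSnd^[n] g) := by
  induction n with
  | zero => exact hg
  | succ n ih => rw [Function.iterate_succ_apply']; exact ih.partialSnd

lemma iteratedDeriv_eq_partialSnd_iterate {g : ℝ × ℝ → ℝ} (hg : ContDiff ℝ ∞ g) (n : ℕ) (x : ℝ) :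
    iteratedDeriv n (fun y => g (x, y)) = fun y => partialSnd^[n] g (x, y) := by
  induction n with
  | zero => rfl
  | succ n ih =>
    rw [iteratedDeriv_succ, ih, Function.iterate_succ_apply']
    funext y
    exact (hasDerivAt_partialSnd (contDiff_partialSnd_iterate hg n) x y).deriv

/-- The sum of the reflections of `φ` in the coordinate axes. -/
def reflectSum (φ : ℝ × ℝ → ℝ) (z : ℝ × ℝ) : ℝ :=
  φ (z.1, z.2) + φ (z.1, -z.2) + (φ (-z.1, z.2) + φ (-z.1, -z.2))

lemma ContDiff.reflectSum {φ : ℝ × ℝ → ℝ} (h : ContDiff ℝ ∞ φ) : ContDiff ℝ ∞ (reflectSum φ) := by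
  unfold _root_.reflectSum
  fun_prop

lemma HasCompactSupport.reflectSum {φ : ℝ × ℝ → ℝ} (h : HasCompactSupport φ) :
    HasCompactSupport (reflectSum φ) := by
  have h1 := h.comp_homeomorph ((Homeomorph.refl ℝ).prodCongr (Homeomorph.neg ℝ))
  have h2 := h.comp_homeomorph ((Homeomorph.neg ℝ).prodCongr (Homeomorph.refl ℝ))
  have h3 := h.comp_homeomorph ((Homeomorph.neg ℝ).prodCongr (Homeomorph.neg ℝ))
  exact (h.add h1).add (h2.add h3)

lemma iteratedDeriv_reflectSum {φ : ℝ × ℝ → ℝ} (h : ContDiff ℝ ∞ φ) (n : ℕ) (x y : ℝ) :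
    iteratedDeriv n (fun y => reflectSum φ (x, y)) y =
      iteratedDeriv n (fun y => φ (x, y)) y + (-1) ^ n * iteratedDeriv n (fun y => φ (x, y)) (-y) +
      (iteratedDeriv n (fun y => φ (-x, y)) y +
        (-1) ^ n * iteratedDeriv n (fun y => φ (-x, y)) (-y)) := by
  have hx : ∀ x, ContDiff ℝ ∞ (fun y => φ (x, y)) := fun x => by fun_prop
  have hx' : ∀ x, ContDiff ℝ ∞ (fun y => φ (x, -y)) := fun x => by fun_prop
  have c : ∀ {g : ℝ → ℝ}, ContDiff ℝ ∞ g → ContDiffAt ℝ n g y := fun hg =>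
    (hg.of_le (by exact_mod_cast le_top)).contDiffAt
  have e : ∀ x, iteratedDeriv n (fun y => φ (x, -y)) y =
      (-1) ^ n * iteratedDeriv n (fun y => φ (x, y)) (-y) := fun x => by
    rw [iteratedDeriv_comp_neg n (fun y => φ (x, y)) y, smul_eq_mul]
  unfold reflectSum
  simp only
  rw [iteratedDeriv_fun_add ((c (hx x)).add (c (hx' x))) ((c (hx (-x))).add (c (hx' (-x)))),
    iteratedDeriv_fun_add (c (hx x)) (c (hx' x)),
    iteratedDeriv_fun_add (c (hx (-x))) (c (hx' (-x))), e, e]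

lemma partialSnd_iterate_reflectSum_zero {φ : ℝ × ℝ → ℝ} (h : ContDiff ℝ ∞ φ) {n : ℕ}
    (hn : Even n) : partialSnd^[n] (reflectSum φ) (0, 0) = 4 * dyOrigin φ n := by
  have e := congrFun (iteratedDeriv_eq_partialSnd_iterate h.reflectSum n 0) 0
  rw [← e, iteratedDeriv_reflectSum h, hn.neg_one_pow, dyOrigin]
  simp only [neg_zero]
  ring

/-- The symmetrization is even in y. The vanishing along the whole axis, not just at the origin, is
what later supplies an extra power of y. -/
lemma partialSnd_iterate_reflectSum_odd {φ : ℝ × ℝ → ℝ} (h : ContDiff ℝ ∞ φ) {n : ℕ}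
    (hn : Odd n) (x : ℝ) : partialSnd^[n] (reflectSum φ) (x, 0) = 0 := by
  have e := congrFun (iteratedDeriv_eq_partialSnd_iterate h.reflectSum n x) 0
  rw [← e, iteratedDeriv_reflectSum h, hn.neg_one_pow]
  simp only [neg_zero]
  ring

/-! ### Mellin integrals over the quadrant. -/

lemma exists_bound_support {g : ℝ × ℝ → ℝ} (hg : Continuous g) (hc : HasCompactSupport g) :
    ∃ R K : ℝ, 1 ≤ R ∧ 0 ≤ K ∧ (∀ z, |g z| ≤ K) ∧ ∀ z, g z ≠ 0 → |z.1| ≤ R ∧ |z.2| ≤ R := by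
  obtain ⟨K, hK⟩ := hc.exists_bound_of_continuous hg
  obtain ⟨R, hR⟩ := hc.isCompact.isBounded.exists_norm_le
  refine ⟨max R 1, K, le_max_right _ _, (norm_nonneg _).trans (hK 0), hK, fun z hz => ?_⟩
  have := hR z (subset_tsupport _ hz)
  exact ⟨(norm_fst_le z).trans (this.trans (le_max_left _ _)),
    (norm_snd_le z).trans (this.trans (le_max_left _ _))⟩

/-- The function `x ^ α` cut off to the interval `(0, R]`. -/
noncomputable def cutPow (R α x : ℝ) : ℝ := (Ioc 0 R).indicator (fun x => x ^ α) x

lemma cutPow_of_mem {R α x : ℝ} (h0 : 0 < x) (hR : x ≤ R) : cutPow R α x = x ^ α :=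
  indicator_of_mem (show x ∈ Ioc 0 R from ⟨h0, hR⟩) _

lemma cutPow_nonneg (R α x : ℝ) : 0 ≤ cutPow R α x :=
  indicator_nonneg (fun _ hx => Real.rpow_nonneg hx.1.le _) _

lemma integrable_cutPow {R α : ℝ} (hR : 0 ≤ R) (hα : -1 < α) :
    Integrable (cutPow R α) (volume.restrict (Ioi 0)) := by
  have h := (intervalIntegral.intervalIntegrable_rpow' (a := 0) (b := R) hα)
  rw [intervalIntegrable_iff_integrableOn_Ioc_of_le hR] at h
  exact (h.integrable_indicator measurableSet_Ioc).restrict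

lemma integral_cutPow {R α : ℝ} (hR : 0 ≤ R) (hα : -1 < α) :
    ∫ x in Ioi 0, cutPow R α x = R ^ (α + 1) / (α + 1) := by
  unfold cutPow
  rw [setIntegral_indicator measurableSet_Ioc, inter_eq_right.2 Ioc_subset_Ioi_self,
    ← intervalIntegral.integral_of_le hR, integral_rpow (Or.inl hα),
    Real.zero_rpow (by linarith), sub_zero]

lemma integrable_cutPow_mul {R α γ : ℝ} (hR : 0 ≤ R) (hα : -1 < α) (hγ : -1 < γ) :
    Integrable (fun z : ℝ × ℝ => cutPow R α z.1 * cutPow R γ z.2) quadMeasure :=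
  (integrable_cutPow hR hα).mul_prod (integrable_cutPow hR hγ)

lemma integral_cutPow_mul {R α γ : ℝ} (hR : 0 ≤ R) (hα : -1 < α) (hγ : -1 < γ) :
    ∫ z : ℝ × ℝ, cutPow R α z.1 * cutPow R γ z.2 ∂quadMeasure =
      R ^ (α + 1) / (α + 1) * (R ^ (γ + 1) / (γ + 1)) := by
  rw [quadMeasure, integral_prod_mul, integral_cutPow hR hα, integral_cutPow hR hγ]

/-- Bounds a range of exponents uniformly on (0, R]: the lowest exponent controls the singularity at
0, and R^δ the rest. -/
lemma rpow_le_mul_rpow {x R α α₁ δ : ℝ} (hx : 0 < x) (hxR : x ≤ R) (hR : 1 ≤ R) (h1 : α₁ ≤ α)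
    (h2 : α ≤ α₁ + δ) : x ^ α ≤ R ^ δ * x ^ α₁ := by
  have e : x ^ α = x ^ (α - α₁) * x ^ α₁ := by rw [← Real.rpow_add hx]; congr 1; ring
  rw [e]
  gcongr
  calc x ^ (α - α₁) ≤ R ^ (α - α₁) := Real.rpow_le_rpow hx.le hxR (by linarith)
    _ ≤ R ^ δ := Real.rpow_le_rpow_of_exponent_le hR (by linarith)

lemma integrableOn_cpow_mul {g : ℝ → ℝ} (hg : Continuous g) (hc : HasCompactSupport g) {c : ℂ}
    (hre : -1 < c.re) : IntegrableOn (fun y : ℝ => (y : ℂ) ^ c * (g y : ℂ)) (Ioi 0) := by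
  obtain ⟨K, hK⟩ := hc.exists_bound_of_continuous hg
  obtain ⟨R, hR⟩ := hc.isCompact.isBounded.exists_norm_le
  have hR0 : (0 : ℝ) ≤ max R 0 := le_max_right _ _
  refine ((integrable_cutPow hR0 hre).mul_const K).mono'
    (Measurable.aestronglyMeasurable (by have := hg.measurable; fun_prop)) ?_
  filter_upwards [ae_restrict_mem measurableSet_Ioi] with y hy
  by_cases h : g y = 0
  · rw [h]
    simpa using mul_nonneg (cutPow_nonneg _ _ _) ((norm_nonneg _).trans (hK 0))
  · have hyR : y ≤ R := (le_abs_self y).trans (hR y (subset_tsupport _ h))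
    rw [norm_mul, Complex.norm_cpow_eq_rpow_re_of_pos hy, cutPow_of_mem hy (hyR.trans (le_max_left _ _)),
      Complex.norm_real]
    exact mul_le_mul_of_nonneg_left (hK y) (Real.rpow_nonneg (le_of_lt hy) _)

/-- Integration by parts; the boundary term vanishes at 0 because Re(c+1) > 0 and at infinity by
compact support. -/
lemma integral_cpow_mul_eq {g g' : ℝ → ℝ} (hg : ∀ y, HasDerivAt g (g' y) y) (hg' : Continuous g')
    (hc : HasCompactSupport g) (hc' : HasCompactSupport g') {c : ℂ} (hre : -1 < c.re) :
    ∫ y in Ioi (0 : ℝ), (y : ℂ) ^ c * (g y : ℂ) =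
      -(1 / (c + 1)) * ∫ y in Ioi (0 : ℝ), (y : ℂ) ^ (c + 1) * (g' y : ℂ) := by
  have hcont : Continuous g := continuous_iff_continuousAt.2 fun y => (hg y).continuousAt
  have hre' : 0 < (c + 1).re := by simp; linarith
  have hc0 : c + 1 ≠ 0 := fun h => by rw [h] at hre'; simp at hre'
  have hv : ∀ y ∈ Ioi (0 : ℝ), HasDerivAt (fun y : ℝ => (y : ℂ) ^ (c + 1) / (c + 1))
      ((y : ℂ) ^ c) y := fun y hy =>
    hasDerivAt_ofReal_cpow_const' (ne_of_gt hy) (r := c) (by rintro rfl; simp at hre)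
  have hu : ∀ y ∈ Ioi (0 : ℝ), HasDerivAt (fun y : ℝ => (g y : ℂ)) ((g' y : ℂ)) y := fun y _ =>
    (hg y).ofReal_comp
  have i1 := integrableOn_cpow_mul hcont hc hre
  have i2 := integrableOn_cpow_mul hg' hc' (c := c + 1) (by linarith)
  have hcv : Continuous fun y : ℝ => (g y : ℂ) * ((y : ℂ) ^ (c + 1) / (c + 1)) :=
    (Complex.continuous_ofReal.comp hcont).mul
      ((Complex.continuous_ofReal_cpow_const hre').div_const _)
  have key := integral_Ioi_mul_deriv_eq_deriv_mul (a := (0 : ℝ)) (a' := (0 : ℂ)) (b' := (0 : ℂ))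
    hu hv ?_ ?_ ?_ ?_
  · simp only [zero_sub, sub_zero] at key
    rw [← integral_const_mul, ← setIntegral_congr_fun measurableSet_Ioi (fun y _ => mul_comm _ _),
      key, ← integral_neg]
    refine setIntegral_congr_fun measurableSet_Ioi fun y _ => ?_
    ring
  · exact i1.congr_fun (fun y _ => mul_comm _ _) measurableSet_Ioi
  · refine IntegrableOn.congr_fun (i2.const_mul (1 / (c + 1))) (fun y _ => ?_) measurableSet_Ioi
    simp only [Pi.mul_apply]
    ring
  · have h := hcv.tendsto 0
    simp only [Complex.ofReal_zero, Complex.zero_cpow hc0, zero_div, mul_zero] at h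
    exact h.mono_left nhdsWithin_le_nhds
  · obtain ⟨R, hR⟩ := hc.isCompact.isBounded.exists_norm_le
    refine tendsto_const_nhds.congr' ?_
    filter_upwards [eventually_gt_atTop R] with y hy
    have : g y = 0 := by
      by_contra h
      exact absurd ((le_abs_self y).trans (hR y (subset_tsupport _ h))) (not_le.2 hy)
    simp [this]

lemma norm_cpow_mul_cpow_le {g : ℝ × ℝ → ℝ} {R K : ℝ} (hR : 1 ≤ R) (hK : ∀ z, |g z| ≤ K)
    (hs : ∀ z, g z ≠ 0 → |z.1| ≤ R ∧ |z.2| ≤ R) {α γ : ℂ} {α₁ γ₁ δ : ℝ}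
    (hα : α₁ ≤ α.re) (hα' : α.re ≤ α₁ + δ) (hγ : γ₁ ≤ γ.re) (hγ' : γ.re ≤ γ₁ + δ)
    {z : ℝ × ℝ} (hz : 0 < z.1 ∧ 0 < z.2) :
    ‖(z.1 : ℂ) ^ α * (z.2 : ℂ) ^ γ * (g z : ℂ)‖ ≤
      R ^ δ * R ^ δ * K * (cutPow R α₁ z.1 * cutPow R γ₁ z.2) := by
  have hK0 : 0 ≤ K := (abs_nonneg _).trans (hK 0)
  by_cases h : g z = 0
  · rw [h]
    have := cutPow_nonneg R α₁ z.1
    have := cutPow_nonneg R γ₁ z.2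
    simp only [Complex.ofReal_zero, mul_zero, norm_zero]
    positivity
  · obtain ⟨h1, h2⟩ := hs z h
    have h1 := (le_abs_self _).trans h1
    have h2 := (le_abs_self _).trans h2
    rw [norm_mul, norm_mul, Complex.norm_cpow_eq_rpow_re_of_pos hz.1,
      Complex.norm_cpow_eq_rpow_re_of_pos hz.2, cutPow_of_mem hz.1 h1, cutPow_of_mem hz.2 h2,
      Complex.norm_real, Real.norm_eq_abs]
    have e1 := rpow_le_mul_rpow hz.1 h1 hR hα hα'
    have e2 := rpow_le_mul_rpow hz.2 h2 hR hγ hγ'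
    have p1 := Real.rpow_nonneg hz.1.le α.re
    have p2 := Real.rpow_nonneg hz.2.le γ.re
    have p3 := Real.rpow_nonneg hz.1.le α₁
    have p4 := Real.rpow_nonneg hz.2.le γ₁
    calc z.1 ^ α.re * z.2 ^ γ.re * |g z|
        ≤ (R ^ δ * z.1 ^ α₁) * (R ^ δ * z.2 ^ γ₁) * K := by
          gcongr
          exact hK z
      _ = _ := by ring

lemma integrable_cpow_mul_cpow_mul {g : ℝ × ℝ → ℝ} (hg : Continuous g) (hc : HasCompactSupport g)
    {α γ : ℂ} (hα : -1 < α.re) (hγ : -1 < γ.re) :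
    Integrable (fun z : ℝ × ℝ => (z.1 : ℂ) ^ α * (z.2 : ℂ) ^ γ * (g z : ℂ)) quadMeasure := by
  obtain ⟨R, K, hR, -, hK, hs⟩ := exists_bound_support hg hc
  refine ((integrable_cutPow_mul (zero_le_one.trans hR) hα hγ).const_mul
    (R ^ (0 : ℝ) * R ^ (0 : ℝ) * K)).mono' (by fun_prop) ?_
  filter_upwards [ae_quadMeasure] with z hz
  exact norm_cpow_mul_cpow_le hR hK hs le_rfl (by simp) le_rfl (by simp) hz

/-- The Mellin-type integral of `g` over the quadrant. -/
noncomputable def quadMellin (g : ℝ × ℝ → ℝ) (α γ : ℂ) : ℂ :=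
  ∫ z : ℝ × ℝ, (z.1 : ℂ) ^ α * (z.2 : ℂ) ^ γ * (g z : ℂ) ∂quadMeasure

lemma quadMellin_eq_partialSnd {g : ℝ × ℝ → ℝ} (hg : ContDiff ℝ ∞ g) (hc : HasCompactSupport g)
    {α γ : ℂ} (hα : -1 < α.re) (hγ : -1 < γ.re) :
    quadMellin g α γ = -(1 / (γ + 1)) * quadMellin (partialSnd g) α (γ + 1) := by
  have i1 := integrable_cpow_mul_cpow_mul hg.continuous hc hα hγ
  have i2 := integrable_cpow_mul_cpow_mul hg.partialSnd.continuous hc.partialSnd hα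
    (γ := γ + 1) (by simp; linarith)
  have slice : ∀ {g : ℝ × ℝ → ℝ}, HasCompactSupport g → ∀ x, HasCompactSupport fun y => g (x, y) :=
    fun {g} h x => h.comp_isClosedEmbedding (Topology.IsClosedEmbedding.of_continuous_injective_isClosedMap
      (by fun_prop) (fun _ _ h => (Prod.ext_iff.1 h).2)
      (isClosedMap_prodMk_left x))
  rw [quadMellin, quadMellin, quadMeasure] at *
  rw [integral_prod _ i1, integral_prod _ i2, ← integral_const_mul]
  refine integral_congr_ae (Eventually.of_forall fun x => ?_)
  simp only [mul_assoc, integral_const_mul]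
  rw [
    integral_cpow_mul_eq (hasDerivAt_partialSnd hg x)
      (hg.partialSnd.continuous.comp (by fun_prop)) (slice hc x) (slice hc.partialSnd x) hγ]
  ring

/-- This is the source of the continuation: the integral on the right only needs Re γ + n > -1. -/
lemma quadMellin_eq_partialSnd_iterate {g : ℝ × ℝ → ℝ} (hg : ContDiff ℝ ∞ g)
    (hc : HasCompactSupport g) {α γ : ℂ} (hα : -1 < α.re) (hγ : -1 < γ.re) (n : ℕ) :
    quadMellin g α γ = (∏ j ∈ Finset.range n, -(1 / (γ + (j + 1)))) *
      quadMellin (partialSnd^[n] g) α (γ + n) := by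
  induction n with
  | zero => simp
  | succ n ih =>
    rw [ih, quadMellin_eq_partialSnd (contDiff_partialSnd_iterate hg n)
      (hasCompactSupport_partialSnd_iterate hc n) hα (by have : (0 : ℝ) ≤ n := n.cast_nonneg; simp; linarith),
      Finset.prod_range_succ, Function.iterate_succ_apply']
    push_cast
    rw [mul_assoc, add_assoc]

lemma differentiable_ofReal_cpow {t : ℝ} (ht : 0 < t) {f : ℂ → ℂ} (hf : Differentiable ℂ f) :
    Differentiable ℂ fun s => (t : ℂ) ^ f s := fun s =>
  (hf s).const_cpow (Or.inl (by exact_mod_cast ht.ne'))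

lemma differentiableAt_quadMellin {g : ℝ × ℝ → ℝ} (hg : Continuous g) (hc : HasCompactSupport g)
    {a b n : ℕ} {s₀ : ℂ} (ha : -1 < a * s₀.re) (hb : -1 < b * s₀.re + n) :
    DifferentiableAt ℂ (fun s : ℂ => quadMellin g (a * s) (b * s + n)) s₀ := by
  obtain ⟨R, K, hR, -, hK, hs⟩ := exists_bound_support hg hc
  obtain ⟨r, hr, h1, h2⟩ : ∃ r : ℝ, 0 < r ∧ -1 < a * (s₀.re - r) ∧ -1 < b * (s₀.re - r) + n := by
    have c1 : Tendsto (fun r : ℝ => a * (s₀.re - r)) (𝓝[>] 0) (𝓝 (a * (s₀.re - 0))) :=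
      ((by fun_prop : Continuous fun r : ℝ => a * (s₀.re - r)).tendsto 0).mono_left
        nhdsWithin_le_nhds
    have c2 : Tendsto (fun r : ℝ => b * (s₀.re - r) + n) (𝓝[>] 0) (𝓝 (b * (s₀.re - 0) + n)) :=
      ((by fun_prop : Continuous fun r : ℝ => b * (s₀.re - r) + n).tendsto 0).mono_left
        nhdsWithin_le_nhds
    rw [sub_zero] at c1 c2
    obtain ⟨r, h⟩ := ((c1.eventually_const_lt ha).and ((c2.eventually_const_lt hb).and
      self_mem_nhdsWithin)).exists
    exact ⟨r, h.2.2, h.1, h.2.1⟩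
  have ha0 : (0 : ℝ) ≤ a := a.cast_nonneg
  have hb0 : (0 : ℝ) ≤ b := b.cast_nonneg
  -- On the ball of radius r the two exponents vary by at most 2ra and 2rb; 2r(a+b) bounds both at
  -- once.
  refine differentiableAt_integral_of_dominated hr
    (B := fun z => R ^ (2 * r * (a + b)) * R ^ (2 * r * (a + b)) * K *
      (cutPow R (a * (s₀.re - r)) z.1 * cutPow R (b * (s₀.re - r) + n) z.2))
    (fun s => Measurable.aestronglyMeasurable (by have := hg.measurable; fun_prop)) ?_ ?_
    ((integrable_cutPow_mul (zero_le_one.trans hR) h1 h2).const_mul _)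
  · filter_upwards [ae_quadMeasure] with z hz
    exact ((differentiable_ofReal_cpow hz.1 (by fun_prop)).mul
      (differentiable_ofReal_cpow hz.2 (by fun_prop))).mul_const _
  · filter_upwards [ae_quadMeasure] with z hz s hsr
    have hre : |s.re - s₀.re| < r := by
      rw [Metric.mem_ball, dist_eq_norm] at hsr
      exact (Complex.abs_re_le_norm (s - s₀)).trans_lt hsr
    obtain ⟨l1, l2⟩ := abs_lt.1 hre
    refine norm_cpow_mul_cpow_le hR hK hs ?_ ?_ ?_ ?_ hz
    · simp only [Complex.mul_re, Complex.natCast_re, Complex.natCast_im, zero_mul, sub_zero]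
      nlinarith
    · simp only [Complex.mul_re, Complex.natCast_re, Complex.natCast_im, zero_mul, sub_zero]
      nlinarith [mul_nonneg hb0 hr.le]
    · simp only [Complex.add_re, Complex.mul_re, Complex.natCast_re, Complex.natCast_im, zero_mul,
        sub_zero]
      nlinarith
    · simp only [Complex.add_re, Complex.mul_re, Complex.natCast_re, Complex.natCast_im, zero_mul,
        sub_zero]
      nlinarith [mul_nonneg ha0 hr.le]

/-! ### Growth of the Mellin integrals at the edge of convergence. -/

lemma norm_quadMellin_le {g : ℝ × ℝ → ℝ} {R K κ : ℝ} (hR : 1 ≤ R)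
    (hK : ∀ z : ℝ × ℝ, 0 < z.1 → 0 < z.2 → |g z| ≤ K * z.2 ^ κ)
    (hs : ∀ z, g z ≠ 0 → |z.1| ≤ R ∧ |z.2| ≤ R) {α γ : ℝ} (hα : -1 < α) (hγ : -1 < γ + κ) :
    ‖quadMellin g α γ‖ ≤ K * (R ^ (α + 1) / (α + 1) * (R ^ (γ + κ + 1) / (γ + κ + 1))) := by
  have hR0 : 0 ≤ R := zero_le_one.trans hR
  rw [← integral_cutPow_mul hR0 hα hγ, ← integral_const_mul]
  refine norm_integral_le_of_norm_le ((integrable_cutPow_mul hR0 hα hγ).const_mul K) ?_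
  filter_upwards [ae_quadMeasure] with z hz
  have hK0 : 0 ≤ K := by
    have := (abs_nonneg _).trans (hK z hz.1 hz.2)
    exact nonneg_of_mul_nonneg_left this (Real.rpow_pos_of_pos hz.2 _)
  by_cases h : g z = 0
  · rw [h]
    have := cutPow_nonneg R α z.1
    have := cutPow_nonneg R (γ + κ) z.2
    simp only [Complex.ofReal_zero, mul_zero, norm_zero]
    positivity
  · obtain ⟨h1, h2⟩ := hs z h
    have h1 := (le_abs_self _).trans h1
    have h2 := (le_abs_self _).trans h2
    rw [norm_mul, norm_mul, Complex.norm_cpow_eq_rpow_re_of_pos hz.1,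
      Complex.norm_cpow_eq_rpow_re_of_pos hz.2, cutPow_of_mem hz.1 h1, cutPow_of_mem hz.2 h2,
      Complex.norm_real, Real.norm_eq_abs, Complex.ofReal_re, Complex.ofReal_re,
      Real.rpow_add hz.2]
    have p1 := Real.rpow_nonneg hz.1.le α
    have p2 := Real.rpow_nonneg hz.2.le γ
    calc z.1 ^ α * z.2 ^ γ * |g z| ≤ z.1 ^ α * z.2 ^ γ * (K * z.2 ^ κ) := by
          gcongr
          exact hK z hz.1 hz.2
      _ = _ := by ring

/-- The boundary behaviour of `quadMellin` is negligible against `ε ^ (-μ)`. -/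
lemma tendsto_rpow_mul_quadMellin_zero {g : ℝ × ℝ → ℝ} {R K κ β η μ A τ : ℝ} (hR : 1 ≤ R)
    (hK : ∀ z : ℝ × ℝ, 0 < z.1 → 0 < z.2 → |g z| ≤ K * z.2 ^ κ) (hK0 : 0 ≤ K)
    (hs : ∀ z, g z ≠ 0 → |z.1| ≤ R ∧ |z.2| ≤ R) (hβ : 0 < β) (hη : 0 ≤ η) (hτ : 0 < τ)
    (hA : ∀ ε : ℝ, 0 < ε → ε ^ (μ - 1) ≤ A * ε ^ τ * (η + β * ε)) :
    Tendsto (fun ε : ℝ => ((ε ^ μ : ℝ) : ℂ) *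
      quadMellin g ((-1 + ε : ℝ) : ℂ) ((η - κ - 1 + β * ε : ℝ) : ℂ)) (𝓝[>] 0) (𝓝 0) := by
  have hR0 : R ≠ 0 := (zero_lt_one.trans_le hR).ne'
  have hb : Tendsto (fun ε : ℝ => K * R ^ ε * R ^ (η + β * ε) * A * ε ^ τ) (𝓝[>] 0) (𝓝 0) := by
    have hc : Continuous fun ε : ℝ => K * R ^ ε * R ^ (η + β * ε) * A * ε ^ τ := by
      have c1 : Continuous fun ε : ℝ => R ^ ε := Real.continuous_const_rpow hR0
      have c2 : Continuous fun ε : ℝ => R ^ (η + β * ε) :=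
        (Real.continuous_const_rpow hR0).comp (by fun_prop)
      have c3 : Continuous fun ε : ℝ => ε ^ τ := Real.continuous_rpow_const hτ.le
      fun_prop
    have := hc.tendsto 0
    rw [Real.zero_rpow hτ.ne', mul_zero] at this
    exact this.mono_left nhdsWithin_le_nhds
  refine squeeze_zero_norm' ?_ hb
  filter_upwards [self_mem_nhdsWithin] with ε hε
  have hε : 0 < ε := hε
  have hpos : 0 < η + β * ε := by positivity
  have h := norm_quadMellin_le (α := -1 + ε) (γ := η - κ - 1 + β * ε) hR hK hs (by linarith)
    (by linarith)
  have e1 : -1 + ε + 1 = ε := by ring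
  have e2 : η - κ - 1 + β * ε + κ + 1 = η + β * ε := by ring
  rw [e1, e2] at h
  rw [norm_mul, Complex.norm_real, Real.norm_of_nonneg (Real.rpow_nonneg hε.le _)]
  have hA' := hA ε hε
  -- The x-integral costs 1/ε and the y-integral 1/(η + βε). The hypothesis `hA` says that ε^{μ-1}
  -- beats the latter, and so treats η > 0 and η = 0 together.
  calc ε ^ μ * _ ≤ ε ^ μ * (K * (R ^ ε / ε * (R ^ (η + β * ε) / (η + β * ε)))) := by gcongr
    _ = K * R ^ ε * R ^ (η + β * ε) * (ε ^ (μ - 1) / (η + β * ε)) := by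
        rw [Real.rpow_sub_one hε.ne']; field_simp
    _ ≤ K * R ^ ε * R ^ (η + β * ε) * (A * ε ^ τ) := by
        have : 0 ≤ R := zero_le_one.trans hR
        gcongr
        rwa [div_le_iff₀ hpos]
    _ = _ := by ring

/-- With g frozen at g(0,0) on the box (0,R]² the integral is exactly g(0,0) R^ε/ε · R^{βε}/(βε).
The error is at most a Lipschitz constant times x + y, and either summand removes one of the two
poles, leaving O(1/ε). -/
lemma tendsto_sq_mul_quadMellin {g : ℝ × ℝ → ℝ} (hg : ContDiff ℝ ∞ g) (hc : HasCompactSupport g)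
    {β : ℝ} (hβ : 0 < β) :
    Tendsto (fun ε : ℝ => ((ε ^ 2 : ℝ) : ℂ) *
      quadMellin g ((-1 + ε : ℝ) : ℂ) ((-1 + β * ε : ℝ) : ℂ)) (𝓝[>] 0)
      (𝓝 ((g (0, 0) / β : ℝ) : ℂ)) := by
  obtain ⟨R, K, hR, -, hK, hs⟩ := exists_bound_support hg.continuous hc
  obtain ⟨C, hC⟩ := hg.lipschitzWith_of_hasCompactSupport hc (by simp)
  have hR0 : 0 ≤ R := zero_le_one.trans hR
  have hR1 : R ≠ 0 := (zero_lt_one.trans_le hR).ne'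
  have c1 : Continuous fun ε : ℝ => R ^ ε := Real.continuous_const_rpow hR1
  have c2 : Continuous fun ε : ℝ => R ^ (β * ε) := c1.comp (by fun_prop)
  have c3 : Continuous fun ε : ℝ => R ^ (ε + 1) := c1.comp (by fun_prop)
  have c4 : Continuous fun ε : ℝ => R ^ (β * ε + 1) := c1.comp (by fun_prop)
  have hmain : Tendsto (fun ε : ℝ => ((R ^ ε * R ^ (β * ε) / β * g (0, 0) : ℝ) : ℂ)) (𝓝[>] 0)
      (𝓝 ((g (0, 0) / β : ℝ) : ℂ)) := by
    have h : Continuous fun ε : ℝ => ((R ^ ε * R ^ (β * ε) / β * g (0, 0) : ℝ) : ℂ) := by fun_prop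
    have := h.tendsto 0
    simp only [mul_zero, Real.rpow_zero, mul_one] at this
    rw [one_div_mul_eq_div] at this
    exact this.mono_left nhdsWithin_le_nhds
  have herr : Tendsto (fun ε : ℝ => C * (R ^ (ε + 1) / (ε + 1) * (R ^ (β * ε) / β) * ε +
      R ^ ε * (R ^ (β * ε + 1) / (β * ε + 1)) * ε)) (𝓝[>] 0) (𝓝 0) := by
    have h : ContinuousAt (fun ε : ℝ => C * (R ^ (ε + 1) / (ε + 1) * (R ^ (β * ε) / β) * ε +
      R ^ ε * (R ^ (β * ε + 1) / (β * ε + 1)) * ε)) 0 := by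
      have d1 := c3.continuousAt (x := 0) |>.div (g := fun ε : ℝ => ε + 1) (by fun_prop) (by simp)
      have d2 := c4.continuousAt (x := 0) |>.div (g := fun ε : ℝ => β * ε + 1) (by fun_prop)
        (by simp)
      exact continuousAt_const.mul (((d1.mul (c2.continuousAt.div_const β)).mul
        continuousAt_id).add ((c1.continuousAt.mul d2).mul continuousAt_id))
    have := h.tendsto
    simp only [mul_zero, add_zero] at this
    exact this.mono_left nhdsWithin_le_nhds
  rw [← sub_zero (((g (0, 0) / β : ℝ) : ℂ))]
  refine (hmain.sub (squeeze_zero_norm' (f := fun ε : ℝ =>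
    ((R ^ ε * R ^ (β * ε) / β * g (0, 0) : ℝ) : ℂ) - ((ε ^ 2 : ℝ) : ℂ) *
      quadMellin g ((-1 + ε : ℝ) : ℂ) ((-1 + β * ε : ℝ) : ℂ)) ?_ herr)).congr fun ε => by ring
  filter_upwards [self_mem_nhdsWithin] with ε hε
  have hε : 0 < ε := hε
  have hβε : 0 < β * ε := by positivity
  have i0 := integrable_cutPow_mul hR0 (show -1 < -1 + ε by linarith)
    (show -1 < -1 + β * ε by linarith)
  have i1 := integrable_cutPow_mul hR0 (show -1 < ε by linarith)
    (show -1 < -1 + β * ε by linarith)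
  have i2 := integrable_cutPow_mul hR0 (show -1 < -1 + ε by linarith)
    (show -1 < β * ε by linarith)
  have v0 := integral_cutPow_mul hR0 (show -1 < -1 + ε by linarith)
    (show -1 < -1 + β * ε by linarith)
  have v1 := integral_cutPow_mul hR0 (show -1 < ε by linarith)
    (show -1 < -1 + β * ε by linarith)
  have v2 := integral_cutPow_mul hR0 (show -1 < -1 + ε by linarith)
    (show -1 < β * ε by linarith)
  have e1 : -1 + ε + 1 = ε := by ring
  have e2 : -1 + β * ε + 1 = β * ε := by ring
  rw [e1, e2] at v0
  rw [e2] at v1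
  rw [e1] at v2
  have iq := integrable_cpow_mul_cpow_mul hg.continuous hc (α := ((-1 + ε : ℝ) : ℂ))
    (γ := ((-1 + β * ε : ℝ) : ℂ)) (by rw [Complex.ofReal_re]; linarith)
    (by rw [Complex.ofReal_re]; linarith)
  have i0' : Integrable (fun z : ℝ × ℝ => ((cutPow R (-1 + ε) z.1 * cutPow R (-1 + β * ε) z.2 *
      g (0, 0) : ℝ) : ℂ)) quadMeasure := (i0.mul_const _).ofReal
  have key : ‖(∫ z : ℝ × ℝ, ((cutPow R (-1 + ε) z.1 * cutPow R (-1 + β * ε) z.2 * g (0, 0) : ℝ) : ℂ)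
      ∂quadMeasure) - quadMellin g ((-1 + ε : ℝ) : ℂ) ((-1 + β * ε : ℝ) : ℂ)‖ ≤
      C * (R ^ (ε + 1) / (ε + 1) * (R ^ (β * ε) / (β * ε)) +
        R ^ ε / ε * (R ^ (β * ε + 1) / (β * ε + 1))) := by
    rw [← v1, ← v2, ← integral_add i1 i2, ← integral_const_mul, quadMellin,
      ← integral_sub i0' iq]
    refine norm_integral_le_of_norm_le ((i1.add i2).const_mul _) ?_
    filter_upwards [ae_quadMeasure] with z hz
    by_cases hz' : z.1 ≤ R ∧ z.2 ≤ R
    · rw [cutPow_of_mem hz.1 hz'.1, cutPow_of_mem hz.1 hz'.1, cutPow_of_mem hz.2 hz'.2,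
        cutPow_of_mem hz.2 hz'.2, ← Complex.ofReal_cpow hz.1.le, ← Complex.ofReal_cpow hz.2.le,
        ← Complex.ofReal_mul, ← Complex.ofReal_mul, ← Complex.ofReal_sub, Complex.norm_real,
        ← mul_sub, norm_mul]
      have p1 := Real.rpow_nonneg hz.1.le (-1 + ε)
      have p2 := Real.rpow_nonneg hz.2.le (-1 + β * ε)
      rw [Real.norm_of_nonneg (mul_nonneg p1 p2)]
      have hl := hC.dist_le_mul (0, 0) z
      have hd : dist ((0, 0) : ℝ × ℝ) z ≤ z.1 + z.2 := by
        rw [Prod.dist_eq, dist_zero_left, dist_zero_left, Real.norm_of_nonneg hz.1.le,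
          Real.norm_of_nonneg hz.2.le]
        exact max_le (by linarith) (by linarith)
      rw [dist_eq_norm] at hl
      have f1 : z.1 ^ ε = z.1 ^ (-1 + ε) * z.1 := by
        rw [← Real.rpow_add_one hz.1.ne']; congr 1; ring
      have f2 : z.2 ^ (β * ε) = z.2 ^ (-1 + β * ε) * z.2 := by
        rw [← Real.rpow_add_one hz.2.ne']; congr 1; ring
      rw [f1, f2]
      calc _ ≤ z.1 ^ (-1 + ε) * z.2 ^ (-1 + β * ε) * (C * (z.1 + z.2)) := by
            gcongr
            exact hl.trans (by gcongr)
        _ = _ := by ring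
    · have hg0 : g z = 0 := by
        by_contra h
        exact hz' ⟨(le_abs_self _).trans (hs z h).1, (le_abs_self _).trans (hs z h).2⟩
      have hz0 : cutPow R (-1 + ε) z.1 * cutPow R (-1 + β * ε) z.2 = 0 := by
        rw [not_and_or] at hz'
        rcases hz' with h | h
        · rw [cutPow, indicator_of_notMem (fun h' => h h'.2), zero_mul]
        · rw [mul_comm, cutPow, indicator_of_notMem (fun h' => h h'.2), zero_mul]
      rw [hz0, hg0]
      simp only [zero_mul, Complex.ofReal_zero, mul_zero, sub_zero, norm_zero]
      have := cutPow_nonneg R ε z.1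
      have := cutPow_nonneg R (-1 + β * ε) z.2
      have := cutPow_nonneg R (-1 + ε) z.1
      have := cutPow_nonneg R (β * ε) z.2
      positivity
  rw [integral_complex_ofReal, integral_mul_const, v0] at key
  have e3 : ((R ^ ε * R ^ (β * ε) / β * g (0, 0) : ℝ) : ℂ) =
      ((ε ^ 2 : ℝ) : ℂ) * ((R ^ ε / ε * (R ^ (β * ε) / (β * ε)) * g (0, 0) : ℝ) : ℂ) := by
    rw [← Complex.ofReal_mul]; congr 1; field_simp
  rw [e3, ← mul_sub, norm_mul, Complex.norm_real, Real.norm_of_nonneg (sq_nonneg ε)]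
  refine (mul_le_mul_of_nonneg_left key (sq_nonneg ε)).trans (le_of_eq ?_)
  have : (0 : ℝ) < ε + 1 := by linarith
  have : (0 : ℝ) < β * ε + 1 := by linarith
  field_simp

/-! ### Differences of powers and the scaling kernel. -/

/-- The derivative s x^{s-1} has norm at most ‖s‖ M^ρ x^{σ-1}, and the right side is the integral of
that bound. It reduces complex s to one real exponent, where the difference has an exact scaling
form. -/
lemma norm_cpow_sub_cpow_le {t₀ t M σ ρ : ℝ} {s : ℂ} (h0 : 0 < t₀) (h1 : t₀ ≤ t) (hM : t ≤ M)
    (hM1 : 1 ≤ M) (hσ : σ < 0) (hs : σ ≤ s.re) (hs' : s.re ≤ σ + ρ) :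
    ‖(t : ℂ) ^ s - (t₀ : ℂ) ^ s‖ ≤ ‖s‖ * M ^ ρ / -σ * (t₀ ^ σ - t ^ σ) := by
  have hpos : ∀ x ∈ Icc t₀ t, 0 < x := fun x hx => h0.trans_le hx.1
  have hc : ContinuousOn (fun x : ℝ => (x : ℂ) ^ s - (t₀ : ℂ) ^ s) (Icc t₀ t) := fun x hx =>
    ((Complex.continuousAt_ofReal_cpow_const x s (Or.inr (hpos x hx).ne')).sub
      continuousAt_const).continuousWithinAt
  refine image_norm_le_of_norm_deriv_right_le_deriv_boundary' (f := fun x : ℝ =>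
    (x : ℂ) ^ s - (t₀ : ℂ) ^ s) (f' := fun x : ℝ => s * (x : ℂ) ^ (s - 1))
    (B := fun x => ‖s‖ * M ^ ρ / -σ * (t₀ ^ σ - x ^ σ))
    (B' := fun x => ‖s‖ * M ^ ρ * x ^ (σ - 1)) hc ?_ (by simp) ?_ ?_ ?_ ⟨h1, le_rfl⟩
  · intro x hx
    have hx0 := hpos x ⟨hx.1, hx.2.le⟩
    by_cases hs0 : s = 0
    · subst hs0
      simpa using (hasDerivWithinAt_const x (Ici x) (0 : ℂ))
    · exact ((hasDerivAt_ofReal_cpow_const hx0.ne' hs0).sub_const _).hasDerivWithinAt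
  · exact continuousOn_const.mul (continuousOn_const.sub (fun x hx =>
      (Real.continuousAt_rpow_const x σ (Or.inl (hpos x hx).ne')).continuousWithinAt))
  · intro x hx
    have hx0 := hpos x ⟨hx.1, hx.2.le⟩
    have := ((Real.hasDerivAt_rpow_const (p := σ) (Or.inl hx0.ne')).const_sub (t₀ ^ σ)).const_mul
      (‖s‖ * M ^ ρ / -σ)
    refine (this.congr_deriv ?_).hasDerivWithinAt
    have := hσ.ne
    field_simp
  · intro x hx
    have hx0 := hpos x ⟨hx.1, hx.2.le⟩
    rw [norm_mul, Complex.norm_cpow_eq_rpow_re_of_pos hx0, mul_assoc, Complex.sub_re,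
      Complex.one_re]
    gcongr
    exact rpow_le_mul_rpow hx0 (hx.2.le.trans hM) hM1 (by linarith) (by linarith)

/-- The kernel arising from `(x^a)^σ - (x^(a-q) (x^q + 1))^σ`, `σ = (ε - 1) / a`, after the
substitution `V = x ^ ε`. -/
noncomputable def scaleKernel (a q : ℕ) (ε V : ℝ) : ℝ :=
  1 - (1 + V ^ (-(q : ℝ) / ε)) ^ ((ε - 1) / a)

section Kernel
variable {a q : ℕ} {ε V : ℝ}

lemma measurable_scaleKernel : Measurable (scaleKernel a q ε) := by
  unfold scaleKernel; fun_prop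

lemma scaleKernel_le_one (hV : 0 < V) : scaleKernel a q ε V ≤ 1 := by
  unfold scaleKernel
  have : 0 < V ^ (-(q : ℝ) / ε) := Real.rpow_pos_of_pos hV _
  linarith [Real.rpow_nonneg (by linarith : 0 ≤ 1 + V ^ (-(q : ℝ) / ε)) ((ε - 1) / a)]

lemma scaleKernel_nonneg (hV : 0 < V) (hε1 : ε < 1) : 0 ≤ scaleKernel a q ε V := by
  unfold scaleKernel
  have : 0 < V ^ (-(q : ℝ) / ε) := Real.rpow_pos_of_pos hV _
  have h : (ε - 1) / (a : ℝ) ≤ 0 := div_nonpos_of_nonpos_of_nonneg (by linarith) a.cast_nonneg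
  linarith [Real.rpow_le_one_of_one_le_of_nonpos
    (by linarith : 1 ≤ 1 + V ^ (-(q : ℝ) / ε)) h]

lemma scaleKernel_le_rpow (ha : 1 ≤ a) (hV : 0 < V) (hε : 0 < ε) (hε1 : ε < 1) :
    scaleKernel a q ε V ≤ V ^ (-(q : ℝ) / ε) := by
  unfold scaleKernel
  have ht : 0 < V ^ (-(q : ℝ) / ε) := Real.rpow_pos_of_pos hV _
  set t := V ^ (-(q : ℝ) / ε)
  have ha' : (1 : ℝ) ≤ a := by exact_mod_cast ha
  have hσ : -1 ≤ (ε - 1) / (a : ℝ) := by rw [le_div_iff₀ (by linarith)]; linarith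
  have hσ' : (ε - 1) / (a : ℝ) ≤ 0 := div_nonpos_of_nonpos_of_nonneg (by linarith) (by linarith)
  rw [Real.rpow_def_of_pos (by linarith)]
  -- With σ = (ε-1)/a in [-1, 0]: 1 - (1+t)^σ ≤ -σ log(1+t) ≤ log(1+t) ≤ t.
  have h1 := Real.add_one_le_exp (Real.log (1 + t) * ((ε - 1) / a))
  have h2 := Real.log_le_sub_one_of_pos (by linarith : 0 < 1 + t)
  have h3 := Real.log_nonneg (by linarith : 1 ≤ 1 + t)
  nlinarith

/-- A dominating function for `scaleKernel`, uniform in `ε`. -/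
noncomputable def scaleMajorant (V : ℝ) : ℝ := cutPow 1 0 V + (Ioi 1).indicator (fun V => V ^ (-2 : ℝ)) V

lemma integrable_scaleMajorant : Integrable scaleMajorant (volume.restrict (Ioi 0)) := by
  refine (integrable_cutPow zero_le_one (by norm_num)).add (Integrable.restrict ?_)
  exact (integrableOn_Ioi_rpow_of_lt (by norm_num) one_pos).integrable_indicator measurableSet_Ioi

lemma scaleKernel_le_majorant (ha : 1 ≤ a) (hq : 2 ≤ q) (hV : 0 < V) (hε : 0 < ε) (hε1 : ε < 1) :
    scaleKernel a q ε V ≤ scaleMajorant V := by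
  unfold scaleMajorant
  by_cases h : V ≤ 1
  · rw [cutPow_of_mem hV h, indicator_of_notMem (by simpa using h), Real.rpow_zero, add_zero]
    exact scaleKernel_le_one hV
  · push Not at h
    rw [cutPow, indicator_of_notMem (by simp [h]), indicator_of_mem (by exact h), zero_add]
    refine (scaleKernel_le_rpow ha hV hε hε1).trans (Real.rpow_le_rpow_of_exponent_le h.le ?_)
    have : (2 : ℝ) ≤ q := by exact_mod_cast hq
    rw [div_le_iff₀ hε]
    linarith

lemma integrable_scaleKernel (ha : 1 ≤ a) (hq : 2 ≤ q) (hε : 0 < ε) (hε1 : ε < 1) :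
    Integrable (scaleKernel a q ε) (volume.restrict (Ioi 0)) := by
  refine integrable_scaleMajorant.mono' measurable_scaleKernel.aestronglyMeasurable ?_
  filter_upwards [ae_restrict_mem measurableSet_Ioi] with V hV
  rw [Real.norm_of_nonneg (scaleKernel_nonneg hV hε1)]
  exact scaleKernel_le_majorant ha hq hV hε hε1

lemma tendsto_rpow_inv_nhdsGT_zero (hV : 0 < V) (hV1 : V < 1) :
    Tendsto (fun ε : ℝ => V ^ ε⁻¹) (𝓝[>] 0) (𝓝 0) :=
  (tendsto_rpow_atTop_of_base_lt_one V (by linarith) hV1).comp tendsto_inv_nhdsGT_zero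

lemma tendsto_scaleKernel_of_lt_one (ha : 1 ≤ a) (hq : 0 < q) (hV : 0 < V) (hV1 : V < 1) :
    Tendsto (fun ε => scaleKernel a q ε V) (𝓝[>] 0) (𝓝 1) := by
  have ha' : (1 : ℝ) ≤ a := by exact_mod_cast ha
  have hq' : (0 : ℝ) < q := by exact_mod_cast hq
  have h0 : Tendsto (fun ε : ℝ => V ^ (-(q : ℝ) / ε)) (𝓝[>] 0) atTop := by
    have : Tendsto (fun ε : ℝ => (q : ℝ) * ε⁻¹) (𝓝[>] 0) atTop :=
      tendsto_inv_nhdsGT_zero.const_mul_atTop hq'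
    have h := (tendsto_rpow_atTop_of_base_gt_one V⁻¹ (one_lt_inv₀ hV |>.2 hV1)).comp this
    refine h.congr fun ε => ?_
    simp only [Function.comp_apply]
    rw [Real.inv_rpow hV.le, ← Real.rpow_neg hV.le]
    congr 1; ring
  -- For ε < 1/2 the moving exponent (ε-1)/a lies below the fixed negative exponent -1/(2a).
  have h1 : Tendsto (fun ε : ℝ => (1 + V ^ (-(q : ℝ) / ε)) ^ (-(1 / (2 * a) : ℝ))) (𝓝[>] 0)
      (𝓝 0) :=
    (tendsto_rpow_neg_atTop (by positivity : (0 : ℝ) < 1 / (2 * a))).comp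
      (tendsto_atTop_add_const_left _ 1 h0)
  have h2 : Tendsto (fun ε : ℝ => (1 + V ^ (-(q : ℝ) / ε)) ^ ((ε - 1) / a)) (𝓝[>] 0) (𝓝 0) := by
    refine squeeze_zero' ?_ ?_ h1
    · refine Eventually.of_forall fun ε => ?_
      have := Real.rpow_pos_of_pos hV (-(q : ℝ) / ε)
      positivity
    · have : ∀ᶠ ε : ℝ in 𝓝[>] 0, ε < 1 / 2 :=
        nhdsWithin_le_nhds (Iio_mem_nhds (by norm_num))
      filter_upwards [this] with ε hε
      have := Real.rpow_pos_of_pos hV (-(q : ℝ) / ε)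
      refine Real.rpow_le_rpow_of_exponent_le (by linarith) ?_
      rw [div_le_iff₀ (by linarith)]
      have : -(1 / (2 * (a : ℝ))) * a = -(1 / 2) := by field_simp
      linarith
  simpa [scaleKernel] using h2.const_sub 1

lemma tendsto_scaleKernel_of_one_lt (ha : 1 ≤ a) (hq : 0 < q) (hV1 : 1 < V) :
    Tendsto (fun ε => scaleKernel a q ε V) (𝓝[>] 0) (𝓝 0) := by
  have hV : 0 < V := by linarith
  have hq' : (0 : ℝ) < q := by exact_mod_cast hq
  have h0 : Tendsto (fun ε : ℝ => V ^ (-(q : ℝ) / ε)) (𝓝[>] 0) (𝓝 0) := by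
    have : Tendsto (fun ε : ℝ => (q : ℝ) * ε⁻¹) (𝓝[>] 0) atTop :=
      tendsto_inv_nhdsGT_zero.const_mul_atTop hq'
    have h := (tendsto_rpow_atTop_of_base_lt_one V⁻¹ (by linarith [inv_pos.2 hV])
      (inv_lt_one_of_one_lt₀ hV1)).comp this
    refine h.congr fun ε => ?_
    simp only [Function.comp_apply]
    rw [Real.inv_rpow hV.le, ← Real.rpow_neg hV.le]
    congr 1; ring
  have : ∀ᶠ ε : ℝ in 𝓝[>] 0, ε < 1 := nhdsWithin_le_nhds (Iio_mem_nhds (by norm_num))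
  refine squeeze_zero' ?_ ?_ h0
  · filter_upwards [this] with ε hε
    exact scaleKernel_nonneg hV hε
  · filter_upwards [this, self_mem_nhdsWithin] with ε hε hε0
    exact scaleKernel_le_rpow ha hV hε0 hε

/-- As `ε → 0+` the kernel averages of a bounded continuous function concentrate at the origin. -/
lemma tendsto_integral_scaleKernel_mul (ha : 1 ≤ a) (hq : 2 ≤ q) {g : ℝ × ℝ → ℝ} {K : ℝ}
    (hg : Continuous g) (hK : ∀ z, |g z| ≤ K) {E y : ℝ → ℝ} (hE0 : ∀ ε, 0 ≤ E ε)
    (hE1 : ∀ᶠ ε in 𝓝[>] 0, E ε ≤ 1) (hy : Tendsto y (𝓝[>] 0) (𝓝 0)) :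
    Tendsto (fun ε => ∫ V in Ioi 0, scaleKernel a q ε V * g (E ε * V ^ ε⁻¹, y ε)) (𝓝[>] 0)
      (𝓝 (g (0, 0))) := by
  have hlim : ∫ V in Ioi (0 : ℝ), (Iio 1).indicator (fun _ => g (0, 0)) V = g (0, 0) := by
    rw [setIntegral_indicator measurableSet_Iio, Ioi_inter_Iio, setIntegral_const]
    simp
  have hlt : ∀ᶠ ε : ℝ in 𝓝[>] 0, ε < 1 := nhdsWithin_le_nhds (Iio_mem_nhds (by norm_num))
  rw [← hlim]
  refine tendsto_integral_filter_of_dominated_convergence (fun V => scaleMajorant V * K) ?_ ?_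
    (integrable_scaleMajorant.mul_const K) ?_
  · refine Eventually.of_forall fun ε => Measurable.aestronglyMeasurable ?_
    have := hg.measurable
    have := measurable_scaleKernel (a := a) (q := q) (ε := ε)
    fun_prop
  · filter_upwards [hlt, self_mem_nhdsWithin] with ε hε hε0
    filter_upwards [ae_restrict_mem measurableSet_Ioi] with V hV
    rw [norm_mul, Real.norm_of_nonneg (scaleKernel_nonneg hV hε)]
    have h := scaleKernel_le_majorant ha hq hV hε0 hε
    exact mul_le_mul h (hK _) (norm_nonneg _) ((scaleKernel_nonneg hV hε).trans h)
  -- For V < 1 the kernel tends to 1 and V^{1/ε} to 0. For V > 1 the point where g is evaluated need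
  -- not converge, but g is bounded and the kernel tends to 0.
  · have h1 : ∀ᵐ V : ℝ ∂(volume.restrict (Ioi 0)), V ≠ 1 :=
      ae_restrict_of_ae (Measure.ae_ne volume 1)
    filter_upwards [ae_restrict_mem measurableSet_Ioi, h1] with V hV hV1
    have hV : 0 < V := hV
    rcases lt_or_gt_of_ne hV1 with h | h
    · rw [indicator_of_mem (by exact h)]
      have hx : Tendsto (fun ε => E ε * V ^ ε⁻¹) (𝓝[>] 0) (𝓝 0) := by
        refine squeeze_zero' (Eventually.of_forall fun ε => mul_nonneg (hE0 ε)
          (Real.rpow_nonneg hV.le _)) ?_ (tendsto_rpow_inv_nhdsGT_zero hV h)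
        filter_upwards [hE1] with ε hε
        exact mul_le_of_le_one_left (Real.rpow_nonneg hV.le _) hε
      have := (tendsto_scaleKernel_of_lt_one (q := q) ha (by omega) hV h).mul
        ((hg.tendsto (0, 0)).comp (hx.prodMk_nhds hy))
      simpa using this
    · rw [indicator_of_notMem (by simpa using h.le)]
      have h0 := (tendsto_scaleKernel_of_one_lt (q := q) ha (by omega) h).mul_const K
      rw [zero_mul] at h0
      refine squeeze_zero_norm' ?_ h0
      filter_upwards [hlt] with ε hε
      rw [norm_mul, Real.norm_of_nonneg (scaleKernel_nonneg hV hε)]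
      exact mul_le_mul_of_nonneg_left (hK _) (scaleKernel_nonneg hV hε)

/-- Pointwise form of the two changes of variable V = u^ε and x = E u with their Jacobians, shared
by the integral formula and the integrability statement. -/
lemma scaleKernel_substitution {E u : ℝ} (hε : 0 < ε) (hE : 0 < E) (hu : 0 < u) (g : ℝ → ℝ) :
    (ε * u ^ (ε - 1)) • (scaleKernel a q ε (u ^ ε) * g (E * (u ^ ε) ^ ε⁻¹)) =
      (fun x => ε * E ^ (1 - ε) * (x ^ (-1 + ε) * scaleKernel a q ε ((x / E) ^ ε) * g x))
        (E * u) := by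
  simp only
  rw [Real.rpow_rpow_inv hu.le hε.ne', mul_div_cancel_left₀ _ hE.ne',
    Real.mul_rpow hE.le hu.le, smul_eq_mul]
  have : E ^ (1 - ε) * E ^ (-1 + ε) = 1 := by
    rw [← Real.rpow_add hE]; simp
  rw [show ε - 1 = -1 + ε by ring]
  linear_combination (-ε * u ^ (-1 + ε) * scaleKernel a q ε (u ^ ε) * g (E * u)) * this

lemma integral_scaleKernel_mul {E : ℝ} (hε : 0 < ε) (hE : 0 < E) (g : ℝ → ℝ) :
    ∫ x in Ioi (0 : ℝ), x ^ (-1 + ε) * scaleKernel a q ε ((x / E) ^ ε) * g x =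
      E ^ ε / ε * ∫ V in Ioi (0 : ℝ), scaleKernel a q ε V * g (E * V ^ ε⁻¹) := by
  rw [← integral_comp_rpow_Ioi_of_pos (g := fun V => scaleKernel a q ε V * g (E * V ^ ε⁻¹)) hε,
    setIntegral_congr_fun measurableSet_Ioi (fun u hu => scaleKernel_substitution hε hE hu g),
    integral_comp_mul_left_Ioi (fun x => ε * E ^ (1 - ε) *
      (x ^ (-1 + ε) * scaleKernel a q ε ((x / E) ^ ε) * g x)) _ hE, mul_zero, integral_const_mul, smul_eq_mul]
  have : E ^ (1 - ε) = E / E ^ ε := by rw [Real.rpow_sub hE, Real.rpow_one]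
  rw [this]
  have := Real.rpow_pos_of_pos hE ε
  field_simp

lemma integrableOn_scaleKernel_mul {E : ℝ} (ha : 1 ≤ a) (hq : 2 ≤ q) (hε : 0 < ε) (hε1 : ε < 1)
    (hE : 0 < E) :
    IntegrableOn (fun x => x ^ (-1 + ε) * scaleKernel a q ε ((x / E) ^ ε)) (Ioi 0) := by
  have h : IntegrableOn (fun V => scaleKernel a q ε V * (1 : ℝ)) (Ioi 0) := by
    simp only [mul_one]; exact integrable_scaleKernel ha hq hε hε1
  rw [← integrableOn_Ioi_comp_rpow_iff _ hε.ne', abs_of_pos hε] at h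
  have h2 := h.congr_fun (fun u hu => scaleKernel_substitution (g := fun _ => 1) hε hE hu)
    measurableSet_Ioi
  rw [integrableOn_Ioi_comp_mul_left_iff (fun x => ε * E ^ (1 - ε) *
      (x ^ (-1 + ε) * scaleKernel a q ε ((x / E) ^ ε) * 1)) _ hE, mul_zero] at h2
  have hne : ε * E ^ (1 - ε) ≠ 0 := (mul_pos hε (Real.rpow_pos_of_pos hE _)).ne'
  refine IntegrableOn.congr_fun (h2.const_mul (ε * E ^ (1 - ε))⁻¹) (fun x _ => ?_)
    measurableSet_Ioi
  simp only [mul_one]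
  rw [inv_mul_cancel_left₀ hne]

end Kernel

/-! ### The flat factor and the model function. -/

/-- The positive `q`-th root of `flatExp p` on the positive half-line. -/
noncomputable def flatRoot (q : ℕ) (p y : ℝ) : ℝ := Real.exp (-1 / (q * y ^ p))

lemma flatExp_of_pos {p y : ℝ} (hy : 0 < y) : flatExp p y = Real.exp (-1 / y ^ p) := by
  rw [flatExp, if_neg hy.ne', abs_of_pos hy]

lemma flatExp_nonneg (p y : ℝ) : 0 ≤ flatExp p y := by
  unfold flatExp; split_ifs <;> positivity

lemma flatExp_le_one (p y : ℝ) : flatExp p y ≤ 1 := by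
  unfold flatExp
  split_ifs
  · exact zero_le_one
  · rw [Real.exp_le_one_iff]
    exact div_nonpos_of_nonpos_of_nonneg (by norm_num) (by positivity)

lemma flatExp_neg (p y : ℝ) : flatExp p (-y) = flatExp p y := by
  simp [flatExp]

lemma measurable_flatExp (p : ℝ) : Measurable (flatExp p) :=
  Measurable.ite (measurableSet_singleton 0) measurable_const (by fun_prop)

lemma measurable_flatRoot (q : ℕ) (p : ℝ) : Measurable (flatRoot q p) := by
  unfold flatRoot; fun_prop

lemma measurable_modelFun (a b q : ℕ) (p : ℝ) : Measurable (modelFun a b q p) := by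
  have := measurable_flatExp p
  unfold modelFun; fun_prop

lemma flatRoot_pos (q : ℕ) (p y : ℝ) : 0 < flatRoot q p y := Real.exp_pos _

lemma flatRoot_le_one (q : ℕ) (p : ℝ) {y : ℝ} (hy : 0 < y) : flatRoot q p y ≤ 1 := by
  rw [flatRoot, Real.exp_le_one_iff]
  exact div_nonpos_of_nonpos_of_nonneg (by norm_num) (by positivity)

lemma flatRoot_pow {q : ℕ} {p y : ℝ} (hq : 0 < q) (hy : 0 < y) :
    flatRoot q p y ^ q = flatExp p y := by
  have hq' : (q : ℝ) ≠ 0 := by exact_mod_cast hq.ne'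
  have := (Real.rpow_pos_of_pos hy p).ne'
  rw [flatExp_of_pos hy, flatRoot, ← Real.exp_nat_mul]
  congr 1
  field_simp

lemma flatRoot_rpow {q : ℕ} {p y ε : ℝ} (hε : 0 < ε) :
    flatRoot q p y ^ ε = Real.exp (-1 / (q / ε * y ^ p)) := by
  rw [flatRoot, ← Real.exp_mul]
  congr 1
  field_simp

lemma modelFun_eq_mul {a b q : ℕ} {p : ℝ} (hqa : q ≤ a) (z : ℝ × ℝ) :
    modelFun a b q p z = z.1 ^ (a - q) * z.2 ^ b * (z.1 ^ q + flatExp p z.2) := by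
  have : z.1 ^ a = z.1 ^ (a - q) * z.1 ^ q := by rw [← pow_add, Nat.sub_add_cancel hqa]
  rw [modelFun, this]; ring

lemma abs_modelFun {a b q : ℕ} {p : ℝ} (hqa : q ≤ a) (hq : Even q) (z : ℝ × ℝ) :
    |modelFun a b q p z| = |z.1| ^ (a - q) * |z.2| ^ b * (|z.1| ^ q + flatExp p z.2) := by
  rw [modelFun_eq_mul hqa, abs_mul, abs_mul, abs_pow, abs_pow, hq.pow_abs,
    abs_of_nonneg (add_nonneg (hq.pow_nonneg _) (flatExp_nonneg _ _))]

lemma monomial_le_modelFun {a b q : ℕ} {p : ℝ} {z : ℝ × ℝ} (hz : 0 < z.1 ∧ 0 < z.2) :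
    z.1 ^ a * z.2 ^ b ≤ modelFun a b q p z := by
  have := flatExp_nonneg p z.2
  obtain ⟨h1, h2⟩ := hz
  rw [modelFun]
  have : 0 ≤ z.1 ^ (a - q) * z.2 ^ b * flatExp p z.2 := by positivity
  linarith

lemma abs_modelFun_le {a b q : ℕ} {p R : ℝ} {z : ℝ × ℝ} (hR : 1 ≤ R) (h1 : |z.1| ≤ R)
    (h2 : |z.2| ≤ R) : |modelFun a b q p z| ≤ 2 * R ^ (a + b) := by
  have h0 : 0 ≤ R := zero_le_one.trans hR
  have e1 : |z.1 ^ a * z.2 ^ b| ≤ R ^ (a + b) := by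
    rw [abs_mul, abs_pow, abs_pow, pow_add]; gcongr
  have e2 : |z.1 ^ (a - q) * z.2 ^ b * flatExp p z.2| ≤ R ^ (a + b) := by
    rw [abs_mul, abs_mul, abs_pow, abs_pow, abs_of_nonneg (flatExp_nonneg _ _), pow_add]
    have := flatExp_nonneg p z.2
    have := flatExp_le_one p z.2
    calc _ ≤ R ^ (a - q) * R ^ b * 1 := by gcongr
      _ ≤ R ^ a * R ^ b := by
          rw [mul_one]
          gcongr
          exact Nat.sub_le _ _
  rw [modelFun]
  exact (abs_add_le _ _).trans (by linarith)

/-! ### The difference from the leading monomial. -/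

section Perturbation
variable {a b q : ℕ} {p ε : ℝ}

/-- On the quadrant f = x^a y^b (1 + (E/x)^q), and V = (x/E)^ε gives V^{-q/ε} = (E/x)^q. -/
lemma monomial_rpow_sub_modelFun_rpow (ha : 0 < a) (hq : 0 < q) (hqa : q ≤ a) (hε : 0 < ε)
    {z : ℝ × ℝ} (hz : 0 < z.1 ∧ 0 < z.2) :
    (z.1 ^ a * z.2 ^ b) ^ ((ε - 1) / a) - modelFun a b q p z ^ ((ε - 1) / a) =
      z.2 ^ (b * ((ε - 1) / a)) *
        (z.1 ^ (-1 + ε) * scaleKernel a q ε ((z.1 / flatRoot q p z.2) ^ ε)) := by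
  obtain ⟨h1, h2⟩ := hz
  have hE := flatRoot_pos q p z.2
  have ha' : (a : ℝ) ≠ 0 := by exact_mod_cast ha.ne'
  have hw : 0 < z.1 / flatRoot q p z.2 := by positivity
  have ht : ((z.1 / flatRoot q p z.2) ^ ε) ^ (-(q : ℝ) / ε) =
      flatRoot q p z.2 ^ q / z.1 ^ q := by
    rw [← Real.rpow_mul hw.le, mul_div_cancel₀ _ hε.ne', Real.rpow_neg hw.le, Real.rpow_natCast,
      div_pow, inv_div]
  have hf : modelFun a b q p z =
      z.1 ^ a * z.2 ^ b * (1 + flatRoot q p z.2 ^ q / z.1 ^ q) := by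
    rw [modelFun, flatRoot_pow hq h2]
    have : z.1 ^ a = z.1 ^ (a - q) * z.1 ^ q := by rw [← pow_add, Nat.sub_add_cancel hqa]
    rw [this]; field_simp
  have hm : (z.1 ^ a * z.2 ^ b) ^ ((ε - 1) / a) =
      z.1 ^ (-1 + ε) * z.2 ^ (b * ((ε - 1) / a)) := by
    rw [Real.mul_rpow (by positivity) (by positivity), ← Real.rpow_natCast, ← Real.rpow_natCast,
      ← Real.rpow_mul h1.le, ← Real.rpow_mul h2.le, mul_div_cancel₀ _ ha']
    congr 2; ring
  rw [scaleKernel, ht, hf, Real.mul_rpow (x := z.1 ^ a * z.2 ^ b) (by positivity) (by positivity), hm]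
  ring

lemma measurable_scaledIntegrand : Measurable fun z : ℝ × ℝ => z.2 ^ (b * ((ε - 1) / a)) *
    (z.1 ^ (-1 + ε) * scaleKernel a q ε ((z.1 / flatRoot q p z.2) ^ ε)) := by
  have := measurable_flatRoot q p
  have := measurable_scaleKernel (a := a) (q := q) (ε := ε)
  fun_prop

lemma integrable_scaledIntegrand (ha : 1 ≤ a) (hq : 2 ≤ q) (hp : 0 < p) (hε : 0 < ε)
    (hε1 : ε < 1) {R : ℝ} :
    Integrable (fun z : ℝ × ℝ => cutPow R 0 z.2 * (z.2 ^ (b * ((ε - 1) / a)) *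
      (z.1 ^ (-1 + ε) * scaleKernel a q ε ((z.1 / flatRoot q p z.2) ^ ε)))) quadMeasure := by
  have hcut : Measurable (cutPow R 0) :=
    Measurable.indicator (by fun_prop) measurableSet_Ioc
  have hmeas : Measurable fun z : ℝ × ℝ => cutPow R 0 z.2 * (z.2 ^ (b * ((ε - 1) / a)) *
      (z.1 ^ (-1 + ε) * scaleKernel a q ε ((z.1 / flatRoot q p z.2) ^ ε))) :=
    (hcut.comp measurable_snd).mul measurable_scaledIntegrand
  rw [quadMeasure, integrable_prod_iff' hmeas.aestronglyMeasurable]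
  constructor
  · refine Eventually.of_forall fun y => ?_
    exact ((integrableOn_scaleKernel_mul ha hq hε hε1 (flatRoot_pos q p y)).const_mul
      (y ^ (b * ((ε - 1) / (a : ℝ))))).const_mul (cutPow R 0 y)
  · have hq' : (0 : ℝ) < q := by exact_mod_cast (by omega : 0 < q)
    have hneg : b * ((ε - 1) / (a : ℝ)) ≤ 0 := mul_nonpos_of_nonneg_of_nonpos b.cast_nonneg
      (div_nonpos_of_nonpos_of_nonneg (by linarith) a.cast_nonneg)
    -- The x-integral leaves a constant times y^{bσ} E^ε. Lowering the exponent by 2, at the cost of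
    -- R² on (0, R], puts it below -1; E^ε still ensures convergence at 0.
    have hdom := integrableOn_rpow_mul_exp_neg_inv (p := p) (r := b * ((ε - 1) / (a : ℝ)) - 2)
      (c := q / ε) hp (by linarith) (by positivity)
    refine (hdom.const_mul (R ^ 2 * (ε⁻¹ *
      ∫ V in Ioi (0 : ℝ), scaleKernel a q ε V))).mono' ?_ ?_
    · exact (hmeas.norm.stronglyMeasurable.integral_prod_left').aestronglyMeasurable
    · filter_upwards [ae_restrict_mem measurableSet_Ioi] with y hy
      have hy : 0 < y := hy
      have hκ : 0 ≤ ∫ V in Ioi (0 : ℝ), scaleKernel a q ε V :=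
        setIntegral_nonneg measurableSet_Ioi fun V hV => scaleKernel_nonneg hV hε1
      have e : ∫ x in Ioi (0 : ℝ), ‖cutPow R 0 y * (y ^ (b * ((ε - 1) / (a : ℝ))) *
          (x ^ (-1 + ε) * scaleKernel a q ε ((x / flatRoot q p y) ^ ε)))‖ =
          cutPow R 0 y * (y ^ (b * ((ε - 1) / (a : ℝ))) * (flatRoot q p y ^ ε / ε *
            ∫ V in Ioi (0 : ℝ), scaleKernel a q ε V)) := by
        have h := integral_scaleKernel_mul (a := a) (q := q) hε (flatRoot_pos q p y)
          (fun _ => (1 : ℝ))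
        simp only [mul_one] at h
        rw [← h, ← integral_const_mul, ← integral_const_mul]
        refine setIntegral_congr_fun measurableSet_Ioi fun x hx => ?_
        have hx : 0 < x := hx
        have h0 := scaleKernel_nonneg (a := a) (q := q) (ε := ε)
          (Real.rpow_pos_of_pos (div_pos hx (flatRoot_pos q p y)) ε) hε1
        have := cutPow_nonneg R 0 y
        exact Real.norm_of_nonneg (by positivity)
      rw [Real.norm_of_nonneg (integral_nonneg fun _ => norm_nonneg _), e]
      by_cases hyR : y ≤ R
      · rw [cutPow_of_mem hy hyR, Real.rpow_zero, one_mul, ← flatRoot_rpow hε,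
          Real.rpow_sub hy, Real.rpow_two]
        have h1 : y ^ 2 ≤ R ^ 2 := by gcongr
        have hE := Real.rpow_pos_of_pos (flatRoot_pos q p y) ε
        have hyy := Real.rpow_pos_of_pos hy (b * ((ε - 1) / (a : ℝ)))
        calc _ = y ^ 2 * (ε⁻¹ * (∫ V in Ioi (0 : ℝ), scaleKernel a q ε V)) *
              (y ^ (b * ((ε - 1) / (a : ℝ))) / y ^ 2 * flatRoot q p y ^ ε) := by
              field_simp
          _ ≤ _ := by gcongr
      · rw [cutPow, indicator_of_notMem (fun h => hyR h.2), zero_mul]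
        have := Real.rpow_nonneg hy.le (b * ((ε - 1) / (a : ℝ)) - 2)
        positivity

/-- The difference between the zeta integral of `modelFun` and the one of its leading monomial,
over the quadrant. -/
noncomputable def perturbIntegral (a b q : ℕ) (p : ℝ) (g : ℝ × ℝ → ℝ) (s : ℂ) : ℂ :=
  ∫ z : ℝ × ℝ, (((modelFun a b q p z : ℝ) : ℂ) ^ s - ((z.1 ^ a * z.2 ^ b : ℝ) : ℂ) ^ s) *
    (g z : ℂ) ∂quadMeasure

lemma differentiableAt_perturbIntegral (ha : 1 ≤ a) (hq : 2 ≤ q) (hqa : q ≤ a) (hp : 0 < p)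
    {g : ℝ × ℝ → ℝ} (hg : Continuous g) (hc : HasCompactSupport g) {s₀ : ℂ}
    (hs₀ : -1 / (a : ℝ) < s₀.re) : DifferentiableAt ℂ (perturbIntegral a b q p g) s₀ := by
  obtain ⟨R, K, hR, hK0, hK, hs⟩ := exists_bound_support hg hc
  have ha' : (0 : ℝ) < a := by exact_mod_cast (by omega : 0 < a)
  -- A real σ strictly between -1/a and min(Re s₀, 0) gives ε = aσ + 1 in (0,1). With r = Re s₀ - σ,
  -- every s in the ball has real part in [σ, σ + 2r].
  obtain ⟨σ, h1, h2⟩ := exists_between (lt_min hs₀ (show -1 / (a : ℝ) < 0 from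
    div_neg_of_neg_of_pos (by norm_num) ha'))
  obtain ⟨hσs, hσ0⟩ := lt_min_iff.1 h2
  obtain ⟨ε, rfl⟩ : ∃ ε, σ = (ε - 1) / (a : ℝ) := ⟨a * σ + 1, by field_simp; ring⟩
  have hε : 0 < ε := by rw [div_lt_div_iff_of_pos_right ha'] at h1; linarith
  have hε1 : ε < 1 := by
    by_contra h
    exact absurd hσ0 (not_lt.2 (div_nonneg (by linarith) ha'.le))
  set σ := (ε - 1) / (a : ℝ) with hσ
  set r := s₀.re - σ with hr
  set M := 2 * R ^ (a + b) with hM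
  have hM1 : 1 ≤ M := by have := one_le_pow₀ hR (n := a + b); linarith
  have hmf := measurable_modelFun a b q p
  refine differentiableAt_integral_of_dominated (r := r) (by linarith)
    (B := fun z => (‖s₀‖ + r) * M ^ (2 * r) / -σ * K * (cutPow R 0 z.2 *
      (z.2 ^ (b * σ) * (z.1 ^ (-1 + ε) * scaleKernel a q ε ((z.1 / flatRoot q p z.2) ^ ε)))))
    (fun s => Measurable.aestronglyMeasurable (by have := hg.measurable; fun_prop)) ?_ ?_
    ((integrable_scaledIntegrand ha hq hp hε hε1).const_mul _)
  · filter_upwards [ae_quadMeasure] with z hz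
    have hz0 : 0 < z.1 ^ a * z.2 ^ b := mul_pos (pow_pos hz.1 _) (pow_pos hz.2 _)
    exact ((differentiable_ofReal_cpow (hz0.trans_le (monomial_le_modelFun hz))
      differentiable_id).sub (differentiable_ofReal_cpow hz0 differentiable_id)).mul_const _
  · filter_upwards [ae_quadMeasure] with z hz s hsr
    rw [Metric.mem_ball, dist_eq_norm] at hsr
    obtain ⟨l1, l2⟩ := abs_lt.1 ((Complex.abs_re_le_norm (s - s₀)).trans_lt hsr)
    rw [Complex.sub_re] at l1 l2
    have hns : ‖s‖ ≤ ‖s₀‖ + r := by linarith [norm_le_norm_add_norm_sub' s s₀]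
    have hz0 : 0 < z.1 ^ a * z.2 ^ b := mul_pos (pow_pos hz.1 _) (pow_pos hz.2 _)
    have hle := monomial_le_modelFun (a := a) (b := b) (q := q) (p := p) hz
    have hσneg : 0 ≤ -σ := by linarith
    have hdiff : 0 ≤ (z.1 ^ a * z.2 ^ b) ^ σ - modelFun a b q p z ^ σ :=
      sub_nonneg.2 (Real.rpow_le_rpow_of_nonpos hz0 hle hσ0.le)
    rw [← monomial_rpow_sub_modelFun_rpow (by omega) (by omega) hqa hε hz, norm_mul,
      Complex.norm_real, Real.norm_eq_abs]
    have hsum : 0 ≤ ‖s₀‖ + r := (norm_nonneg s).trans hns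
    by_cases h : g z = 0
    · rw [h, abs_zero, mul_zero]
      have := cutPow_nonneg R 0 z.2
      positivity
    · obtain ⟨b1, b2⟩ := hs z h
      rw [cutPow_of_mem hz.2 ((le_abs_self _).trans b2), Real.rpow_zero, one_mul]
      have := norm_cpow_sub_cpow_le (s := s) (ρ := 2 * r) hz0 hle
        ((le_abs_self _).trans (abs_modelFun_le hR b1 b2)) hM1 hσ0 (by linarith) (by linarith)
      calc _ ≤ (‖s‖ * M ^ (2 * r) / -σ *
              ((z.1 ^ a * z.2 ^ b) ^ σ - modelFun a b q p z ^ σ)) * K :=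
            mul_le_mul this (hK z) (abs_nonneg _) ((norm_nonneg _).trans this)
        _ ≤ ((‖s₀‖ + r) * M ^ (2 * r) / -σ *
              ((z.1 ^ a * z.2 ^ b) ^ σ - modelFun a b q p z ^ σ)) * K := by gcongr
        _ = _ := by ring

/-- The kernel average of `g` on the horizontal line at height `y`. -/
noncomputable def kernelAverage (a q : ℕ) (p : ℝ) (g : ℝ × ℝ → ℝ) (ε y : ℝ) : ℝ :=
  ∫ V in Ioi (0 : ℝ), scaleKernel a q ε V * g (flatRoot q p y * V ^ ε⁻¹, y)

/-- Fubini with the x-integral done first: it equals E^ε/ε times the kernel average, leaving a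
one-dimensional integral from which all asymptotics are read. -/
lemma perturbIntegral_ofReal (ha : 1 ≤ a) (hq : 2 ≤ q) (hqa : q ≤ a) (hp : 0 < p)
    {g : ℝ × ℝ → ℝ} (hg : Continuous g) (hc : HasCompactSupport g) (hε : 0 < ε) (hε1 : ε < 1) :
    perturbIntegral a b q p g (((ε - 1) / a : ℝ) : ℂ) = ((-ε⁻¹ * ∫ y in Ioi (0 : ℝ),
      y ^ (b * ((ε - 1) / a)) * flatRoot q p y ^ ε * kernelAverage a q p g ε y : ℝ) : ℂ) := by
  obtain ⟨R, K, hR, hK0, hK, hs⟩ := exists_bound_support hg hc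
  set f : ℝ × ℝ → ℝ := fun z => z.2 ^ (b * ((ε - 1) / a)) *
    (z.1 ^ (-1 + ε) * scaleKernel a q ε ((z.1 / flatRoot q p z.2) ^ ε)) with hf
  have hfi : Integrable (fun z => f z * g z) quadMeasure := by
    refine ((integrable_scaledIntegrand (b := b) (R := R) ha hq hp hε hε1).mul_const K).mono'
      (measurable_scaledIntegrand.mul hg.measurable).aestronglyMeasurable ?_
    filter_upwards [ae_quadMeasure] with z hz
    have hf0 : 0 ≤ f z := by
      have := scaleKernel_nonneg (a := a) (q := q) (Real.rpow_pos_of_pos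
        (div_pos hz.1 (flatRoot_pos q p z.2)) ε) hε1
      have := hz.1
      have := hz.2
      simp only [hf]
      positivity
    by_cases h : g z = 0
    · rw [h, mul_zero, norm_zero]
      have := cutPow_nonneg R 0 z.2
      positivity
    · rw [cutPow_of_mem hz.2 ((le_abs_self _).trans (hs z h).2), Real.rpow_zero, one_mul,
        norm_mul, Real.norm_of_nonneg hf0]
      exact mul_le_mul_of_nonneg_left (hK z) hf0
  have e : perturbIntegral a b q p g (((ε - 1) / a : ℝ) : ℂ) =
      ((-∫ z, f z * g z ∂quadMeasure : ℝ) : ℂ) := by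
    rw [perturbIntegral, ← integral_neg, ← integral_complex_ofReal]
    refine integral_congr_ae ?_
    filter_upwards [ae_quadMeasure] with z hz
    have hz0 : 0 < z.1 ^ a * z.2 ^ b := mul_pos (pow_pos hz.1 _) (pow_pos hz.2 _)
    simp only [hf]
    rw [← monomial_rpow_sub_modelFun_rpow (by omega) (by omega) hqa hε hz,
      ← Complex.ofReal_cpow hz0.le, ← Complex.ofReal_cpow
      (hz0.le.trans (monomial_le_modelFun hz))]
    push_cast
    ring
  rw [e]
  congr 1
  rw [quadMeasure] at hfi ⊢
  rw [integral_prod_symm _ hfi, neg_mul, ← integral_const_mul]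
  congr 1
  refine integral_congr_ae (Eventually.of_forall fun y => ?_)
  simp only [hf]
  have := integral_scaleKernel_mul (a := a) (q := q) hε (flatRoot_pos q p y) (fun x => g (x, y))
  simp only [mul_assoc] at this ⊢
  rw [integral_const_mul, this, kernelAverage]
  ring

lemma abs_kernelAverage_le (ha : 1 ≤ a) (hq : 2 ≤ q) (hε : 0 < ε) (hε1 : ε < 1)
    {g : ℝ × ℝ → ℝ} {K : ℝ} (hK : ∀ z, |g z| ≤ K) (y : ℝ) :
    |kernelAverage a q p g ε y| ≤ K * ∫ V in Ioi (0 : ℝ), scaleMajorant V := by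
  rw [kernelAverage, ← integral_const_mul, ← Real.norm_eq_abs]
  refine norm_integral_le_of_norm_le (integrable_scaleMajorant.const_mul K) ?_
  filter_upwards [ae_restrict_mem measurableSet_Ioi] with V hV
  have h0 := scaleKernel_nonneg (a := a) (q := q) (ε := ε) hV hε1
  have h1 := scaleKernel_le_majorant ha hq hV hε hε1
  rw [norm_mul, Real.norm_of_nonneg h0, mul_comm K]
  exact mul_le_mul h1 (hK _) (norm_nonneg _) (h0.trans h1)

lemma measurable_kernelAverage {g : ℝ × ℝ → ℝ} (hg : Continuous g) :
    Measurable (kernelAverage a q p g ε) := by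
  have hm : Measurable fun z : ℝ × ℝ =>
      scaleKernel a q ε z.2 * g (flatRoot q p z.1 * z.2 ^ ε⁻¹, z.1) := by
    have := measurable_flatRoot q p
    have := measurable_scaleKernel (a := a) (q := q) (ε := ε)
    have := hg.measurable
    fun_prop
  exact (hm.stronglyMeasurable.integral_prod_right' (ν := volume.restrict (Ioi 0))).measurable

end Perturbation

/-! ### Asymptotics of the difference as ε → 0+. -/

lemma tendsto_rpow_const_mul_self (c : ℝ) :
    Tendsto (fun ε : ℝ => ε ^ (c * ε)) (𝓝[>] 0) (𝓝 1) := by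
  have h := ((Real.continuous_mul_log.tendsto 0).const_mul c).mono_left
    (nhdsWithin_le_nhds (s := Ioi 0))
  rw [zero_mul, mul_zero] at h
  have h2 := (Real.continuous_exp.tendsto 0).comp h
  rw [Real.exp_zero] at h2
  refine h2.congr' ?_
  filter_upwards [self_mem_nhdsWithin] with ε hε
  rw [Function.comp_apply, Real.rpow_def_of_pos hε]
  congr 1; ring

lemma exp_neg_le_rpow_neg {t δ : ℝ} (ht : 0 < t) (hδ : 0 ≤ δ) (hδ1 : δ ≤ 1) :
    Real.exp (-t) ≤ t ^ (-δ) := by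
  rw [Real.rpow_def_of_pos ht, Real.exp_le_exp]
  nlinarith [Real.log_le_sub_one_of_pos ht]

lemma eventually_nhdsGT_zero_lt_one : ∀ᶠ ε : ℝ in 𝓝[>] 0, ε < 1 :=
  nhdsWithin_le_nhds (Iio_mem_nhds one_pos)

section PerturbationAsymptotics
variable {a b q : ℕ} {p : ℝ}

lemma mul_sub_one_div_eq (b a : ℕ) (ε : ℝ) :
    b * ((ε - 1) / (a : ℝ)) = -((b : ℝ) / a) + (b : ℝ) / a * ε := by ring

/-- Under y = ε^{1/p} u the factor E(y)^ε becomes e^{-1/(q u^p)}, free of ε; this fixes the exponent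
1 + (β-1)/p and leaves only ε^{(β/p)ε}, which tends to 1. -/
lemma integral_rescale (hp : 0 < p) {g : ℝ × ℝ → ℝ} {ε : ℝ} (hε : 0 < ε) :
    ε ^ (1 + ((b : ℝ) / a - 1) / p) * (-ε⁻¹ * ∫ y in Ioi (0 : ℝ),
      y ^ (b * ((ε - 1) / (a : ℝ))) * flatRoot q p y ^ ε * kernelAverage a q p g ε y) =
    -(ε ^ ((b : ℝ) / a / p * ε) * ∫ u in Ioi (0 : ℝ), u ^ (-((b : ℝ) / a) + (b : ℝ) / a * ε) *
      Real.exp (-1 / (q * u ^ p)) * kernelAverage a q p g ε (ε ^ p⁻¹ * u)) := by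
  have hl : 0 < ε ^ p⁻¹ := Real.rpow_pos_of_pos hε _
  rw [mul_sub_one_div_eq]
  set β := (b : ℝ) / a
  have h := integral_comp_mul_left_Ioi' (fun y : ℝ => y ^ (-β + β * ε) * flatRoot q p y ^ ε *
    kernelAverage a q p g ε y) 0 hl
  rw [mul_zero] at h
  have e : ∀ u ∈ Ioi (0 : ℝ), (ε ^ p⁻¹ * u) ^ (-β + β * ε) * flatRoot q p (ε ^ p⁻¹ * u) ^ ε *
      kernelAverage a q p g ε (ε ^ p⁻¹ * u) = (ε ^ p⁻¹) ^ (-β + β * ε) * (u ^ (-β + β * ε) *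
      Real.exp (-1 / (q * u ^ p)) * kernelAverage a q p g ε (ε ^ p⁻¹ * u)) := fun u hu => by
    have hu : 0 < u := hu
    rw [flatRoot_rpow hε, Real.mul_rpow hl.le hu.le, Real.mul_rpow hl.le hu.le,
      Real.rpow_inv_rpow hε.le hp.ne', ← mul_assoc (q / ε : ℝ), div_mul_cancel₀ _ hε.ne']
    ring
  rw [← h, setIntegral_congr_fun measurableSet_Ioi e, integral_const_mul, smul_eq_mul]
  have e2 : ε ^ (1 + (β - 1) / p) * (ε⁻¹ * (ε ^ p⁻¹ * (ε ^ p⁻¹) ^ (-β + β * ε))) =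
      ε ^ (β / p * ε) := by
    rw [← Real.rpow_neg_one, ← Real.rpow_mul hε.le, ← Real.rpow_add hε, ← Real.rpow_add hε,
      ← Real.rpow_add hε]
    congr 1
    field_simp
    ring
  rw [← e2]; ring

lemma tendsto_rpow_mul_perturbIntegral (ha : 1 ≤ a) (hq : 2 ≤ q) (hqa : q ≤ a) (hp : 0 < p)
    (hab : 1 < (b : ℝ) / a) {g : ℝ × ℝ → ℝ} (hg : Continuous g) (hc : HasCompactSupport g) :
    Tendsto (fun ε : ℝ => ((ε ^ (1 + ((b : ℝ) / a - 1) / p) : ℝ) : ℂ) *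
      perturbIntegral a b q p g (((ε - 1) / a : ℝ) : ℂ)) (𝓝[>] 0)
      (𝓝 ((-((∫ u in Ioi (0 : ℝ), u ^ (-((b : ℝ) / a)) * Real.exp (-1 / (q * u ^ p))) *
        g (0, 0)) : ℝ) : ℂ)) := by
  obtain ⟨R, K, hR, hK0, hK, hs⟩ := exists_bound_support hg hc
  have hq' : (0 : ℝ) < q := by exact_mod_cast (by omega : 0 < q)
  have hlam : Tendsto (fun ε : ℝ => ε ^ p⁻¹) (𝓝[>] 0) (𝓝 0) := by
    have := (Real.continuous_rpow_const (inv_pos.2 hp).le).tendsto 0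
    rw [Real.zero_rpow (inv_pos.2 hp).ne'] at this
    exact this.mono_left nhdsWithin_le_nhds
  have main : Tendsto (fun ε : ℝ => ∫ u in Ioi (0 : ℝ),
      u ^ (-((b : ℝ) / a) + (b : ℝ) / a * ε) * Real.exp (-1 / (q * u ^ p)) *
        kernelAverage a q p g ε (ε ^ p⁻¹ * u)) (𝓝[>] 0)
      (𝓝 (∫ u in Ioi (0 : ℝ), u ^ (-((b : ℝ) / a)) * Real.exp (-1 / (q * u ^ p)) * g (0, 0))) := by
    set β := (b : ℝ) / a with hβ
    set A := K * ∫ V in Ioi (0 : ℝ), scaleMajorant V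
    -- This keeps -β + βε between -β and -(β+1)/2, both below -1, so the two end powers dominate.
    have hlt : ∀ᶠ ε : ℝ in 𝓝[>] 0, ε < (β - 1) / (2 * β) :=
      nhdsWithin_le_nhds (Iio_mem_nhds (div_pos (by linarith) (by linarith)))
    refine tendsto_integral_filter_of_dominated_convergence
      (fun u => (u ^ (-β) * Real.exp (-1 / (q * u ^ p)) +
        u ^ (-((β + 1) / 2)) * Real.exp (-1 / (q * u ^ p))) * A) ?_ ?_
      (((integrableOn_rpow_mul_exp_neg_inv hp (by linarith) hq').add
        (integrableOn_rpow_mul_exp_neg_inv hp (by linarith) hq')).mul_const A) ?_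
    · refine Eventually.of_forall fun ε => Measurable.aestronglyMeasurable ?_
      have := measurable_kernelAverage (a := a) (q := q) (p := p) (ε := ε) hg
      fun_prop
    · filter_upwards [eventually_nhdsGT_zero_lt_one, hlt, self_mem_nhdsWithin] with ε h1 h2 h0
      have h0 : 0 < ε := h0
      filter_upwards [ae_restrict_mem measurableSet_Ioi] with u hu
      have hu : 0 < u := hu
      have hav := abs_kernelAverage_le (p := p) ha hq h0 h1 hK (ε ^ p⁻¹ * u)
      rw [lt_div_iff₀ (by linarith)] at h2
      have hpow : u ^ (-β + β * ε) ≤ u ^ (-β) + u ^ (-((β + 1) / 2)) := by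
        rcases le_total u 1 with h | h
        · have := Real.rpow_le_rpow_of_exponent_ge hu h
            (show -β ≤ -β + β * ε by nlinarith)
          linarith [Real.rpow_nonneg hu.le (-((β + 1) / 2))]
        · have := Real.rpow_le_rpow_of_exponent_le h
            (show -β + β * ε ≤ -((β + 1) / 2) by nlinarith)
          linarith [Real.rpow_nonneg hu.le (-β)]
      rw [norm_mul, norm_mul, Real.norm_of_nonneg (Real.rpow_nonneg hu.le _),
        Real.norm_of_nonneg (Real.exp_nonneg _), ← add_mul, Real.norm_eq_abs]
      have := Real.rpow_nonneg hu.le (-β)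
      have := Real.rpow_nonneg hu.le (-((β + 1) / 2))
      gcongr
    · filter_upwards [ae_restrict_mem measurableSet_Ioi] with u hu
      have hu : 0 < u := hu
      have c1 : Tendsto (fun ε : ℝ => u ^ (-β + β * ε)) (𝓝[>] 0) (𝓝 (u ^ (-β))) := by
        have hc : Continuous fun ε : ℝ => u ^ (-β + β * ε) :=
          (Real.continuous_const_rpow hu.ne').comp (by fun_prop)
        have := hc.tendsto 0
        rw [mul_zero, add_zero] at this
        exact this.mono_left nhdsWithin_le_nhds
      have hy : Tendsto (fun ε : ℝ => ε ^ p⁻¹ * u) (𝓝[>] 0) (𝓝 0) := by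
        simpa using hlam.mul_const u
      have c2 : Tendsto (fun ε => kernelAverage a q p g ε (ε ^ p⁻¹ * u)) (𝓝[>] 0)
          (𝓝 (g (0, 0))) := by
        refine tendsto_integral_scaleKernel_mul (E := fun ε => flatRoot q p (ε ^ p⁻¹ * u)) ha hq
          hg hK (fun ε => (flatRoot_pos _ _ _).le) ?_ hy
        filter_upwards [self_mem_nhdsWithin] with ε hε
        exact flatRoot_le_one q p (mul_pos (Real.rpow_pos_of_pos hε _) hu)
      exact (c1.mul_const _).mul c2
  have h := ((tendsto_rpow_const_mul_self ((b : ℝ) / a / p)).mul main).neg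
  rw [one_mul, integral_mul_const] at h
  have h' := (Complex.continuous_ofReal.tendsto _).comp h
  refine h'.congr' ?_
  filter_upwards [eventually_nhdsGT_zero_lt_one, self_mem_nhdsWithin] with ε h1 h0
  rw [Function.comp_apply, perturbIntegral_ofReal ha hq hqa hp hg hc h0 h1, ← Complex.ofReal_mul,
    integral_rescale hp h0]

/-- Choose δ with (β-1)/p < δ < 1 and use E^ε ≤ (q/ε)^δ y^{pδ}. Then -β + pδ > -1 makes the
y-integral O(ε^{-δ}), so the whole expression is O(ε^{1-δ}); β = 1 is allowed. -/
lemma tendsto_sq_mul_perturbIntegral (ha : 1 ≤ a) (hq : 2 ≤ q) (hqa : q ≤ a) (hp : 0 < p)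
    (hab : 1 ≤ (b : ℝ) / a) (hpb : (b : ℝ) / a - 1 < p) {g : ℝ × ℝ → ℝ} (hg : Continuous g)
    (hc : HasCompactSupport g) :
    Tendsto (fun ε : ℝ => ((ε ^ 2 : ℝ) : ℂ) *
      perturbIntegral a b q p g (((ε - 1) / a : ℝ) : ℂ)) (𝓝[>] 0) (𝓝 0) := by
  obtain ⟨R, K, hR, hK0, hK, hs⟩ := exists_bound_support hg hc
  have hR0 : 0 ≤ R := zero_le_one.trans hR
  have hq' : (0 : ℝ) < q := by exact_mod_cast (by omega : 0 < q)
  set A := K * ∫ V in Ioi (0 : ℝ), scaleMajorant V with hA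
  have hA0 : 0 ≤ A := (abs_nonneg _).trans
    (abs_kernelAverage_le (p := p) ha hq (ε := 1 / 2) (by norm_num) (by norm_num) hK 0)
  obtain ⟨δ, hδ, hδ1⟩ := exists_between ((div_lt_one hp).2 hpb)
  have hδ0 : 0 < δ := (div_nonneg (by linarith) hp.le).trans_lt hδ
  rw [div_lt_iff₀ hp] at hδ
  set β := (b : ℝ) / a with hβ
  obtain ⟨η, hη⟩ : ∃ η, η = 1 - β + p * δ := ⟨_, rfl⟩
  have hη0 : 0 < η := by rw [hη]; linarith
  have hb : Tendsto (fun ε : ℝ => ε ^ (1 - δ) * ((q : ℝ) ^ δ * A * R ^ (η + β * ε) / η))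
      (𝓝[>] 0) (𝓝 0) := by
    have c1 : Continuous fun ε : ℝ => ε ^ (1 - δ) := Real.continuous_rpow_const (by linarith)
    have c2 : Continuous fun ε : ℝ => R ^ (η + β * ε) :=
      (Real.continuous_const_rpow (zero_lt_one.trans_le hR).ne').comp (by fun_prop)
    have hc : Continuous fun ε : ℝ => ε ^ (1 - δ) * ((q : ℝ) ^ δ * A * R ^ (η + β * ε) / η) := by
      fun_prop
    have := hc.tendsto 0
    rw [Real.zero_rpow (by linarith), zero_mul] at this
    exact this.mono_left nhdsWithin_le_nhds
  refine squeeze_zero_norm' ?_ hb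
  filter_upwards [eventually_nhdsGT_zero_lt_one, self_mem_nhdsWithin] with ε h1 h0
  have h0 : 0 < ε := h0
  rw [perturbIntegral_ofReal ha hq hqa hp hg hc h0 h1, ← Complex.ofReal_mul, Complex.norm_real,
    mul_sub_one_div_eq, ← hβ]
  have hβε : 0 < β * ε := by positivity
  have hγ : -1 < η - 1 + β * ε := by linarith
  have key : ‖∫ y in Ioi (0 : ℝ), y ^ (-β + β * ε) * flatRoot q p y ^ ε *
      kernelAverage a q p g ε y‖ ≤
      (q / ε) ^ δ * A * (R ^ (η - 1 + β * ε + 1) / (η - 1 + β * ε + 1)) := by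
    rw [← integral_cutPow hR0 hγ, ← integral_const_mul]
    refine norm_integral_le_of_norm_le ((integrable_cutPow hR0 hγ).const_mul _) ?_
    filter_upwards [ae_restrict_mem measurableSet_Ioi] with y hy
    have hy : 0 < y := hy
    by_cases hyR : y ≤ R
    · rw [cutPow_of_mem hy hyR, norm_mul, norm_mul, Real.norm_of_nonneg (Real.rpow_nonneg hy.le _),
        Real.norm_of_nonneg (Real.rpow_nonneg (flatRoot_pos _ _ _).le _), flatRoot_rpow h0,
        neg_div]
      have hyp := Real.rpow_pos_of_pos hy p
      have e1 : Real.exp (-(1 / (q / ε * y ^ p))) ≤ (q / ε) ^ δ * y ^ (p * δ) := by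
        refine (exp_neg_le_rpow_neg (by positivity) hδ0.le hδ1.le).trans (le_of_eq ?_)
        rw [Real.rpow_neg (by positivity), one_div, Real.inv_rpow (by positivity), inv_inv,
          Real.mul_rpow (by positivity) hyp.le, Real.rpow_mul hy.le]
      have e2 : y ^ (η - 1 + β * ε) = y ^ (-β + β * ε) * y ^ (p * δ) := by
        rw [← Real.rpow_add hy, hη]; congr 1; ring
      rw [e2]
      have := Real.rpow_nonneg hy.le (-β + β * ε)
      have hav := abs_kernelAverage_le (p := p) ha hq h0 h1 hK y
      calc _ ≤ y ^ (-β + β * ε) * ((q / ε) ^ δ * y ^ (p * δ)) * A := by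
            rw [Real.norm_eq_abs]; gcongr
        _ = _ := by ring
    · have hz : kernelAverage a q p g ε y = 0 := by
        rw [kernelAverage]
        refine integral_eq_zero_of_ae (Eventually.of_forall fun V => ?_)
        have : g (flatRoot q p y * V ^ ε⁻¹, y) = 0 := by
          by_contra h
          exact hyR ((le_abs_self _).trans (hs _ h).2)
        simp [this]
      rw [hz, mul_zero, norm_zero]
      have := cutPow_nonneg R (η - 1 + β * ε) y
      positivity
  have e3 : η - 1 + β * ε + 1 = η + β * ε := by ring
  rw [e3] at key
  rw [norm_mul, norm_mul, norm_neg, norm_inv, Real.norm_of_nonneg (sq_nonneg ε),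
    Real.norm_of_nonneg h0.le]
  calc _ ≤ ε ^ 2 * (ε⁻¹ * ((q / ε) ^ δ * A * (R ^ (η + β * ε) / η))) := by
        gcongr
        refine key.trans ?_
        gcongr
        linarith
    _ = _ := by
        rw [Real.div_rpow hq'.le h0.le, Real.rpow_sub h0, Real.rpow_one]
        have := (Real.rpow_pos_of_pos h0 δ).ne'
        field_simp

end PerturbationAsymptotics

/-! ### The continuation and its boundary limits. -/

section Continuation
variable {a b q : ℕ} {p : ℝ}

lemma integrable_zetaIntegrand (a b q : ℕ) (p : ℝ) {φ : ℝ × ℝ → ℝ} (hφ : Continuous φ)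
    (hφc : HasCompactSupport φ) {s : ℂ} (hs : 0 < s.re) :
    Integrable (zetaIntegrand (modelFun a b q p) φ s) := by
  obtain ⟨R, K, hR, hK0, hK, hsupp⟩ := exists_bound_support hφ hφc
  have hbox : IntegrableOn (fun _ : ℝ × ℝ => (2 * R ^ (a + b)) ^ s.re * K)
      (Icc (-R) R ×ˢ Icc (-R) R) :=
    integrableOn_const (isCompact_Icc.prod isCompact_Icc).measure_lt_top.ne
  refine (hbox.integrable_indicator (measurableSet_Icc.prod measurableSet_Icc)).mono' ?_
    (Eventually.of_forall fun z => ?_)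
  · have := hφ.measurable
    refine Measurable.aestronglyMeasurable ?_
    unfold zetaIntegrand
    have h1 : Measurable fun z => |modelFun a b q p z| := measurable_norm.comp (measurable_modelFun a b q p)
    fun_prop
  · by_cases h : φ z = 0
    · rw [zetaIntegrand, h, Complex.ofReal_zero, mul_zero, norm_zero]
      exact indicator_nonneg (fun _ _ => by positivity) _
    · obtain ⟨h1, h2⟩ := hsupp z h
      have hz : z ∈ Icc (-R) R ×ˢ Icc (-R) R := ⟨abs_le.1 h1, abs_le.1 h2⟩
      rw [indicator_of_mem hz, zetaIntegrand, norm_mul,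
        Complex.norm_cpow_eq_rpow_re_of_nonneg (abs_nonneg _) hs.ne', Complex.norm_real]
      have := abs_modelFun_le (a := a) (b := b) (q := q) (p := p) hR h1 h2
      exact mul_le_mul (Real.rpow_le_rpow (abs_nonneg _) this hs.le) (hK z) (norm_nonneg _)
        (by positivity)

lemma ofReal_monomial_cpow {x y : ℝ} (hx : 0 < x) (hy : 0 < y) (s : ℂ) :
    ((x ^ a * y ^ b : ℝ) : ℂ) ^ s = (x : ℂ) ^ (a * s) * (y : ℂ) ^ (b * s) := by
  have e : ∀ {t : ℝ} (n : ℕ), 0 < t → (t : ℂ) ^ (n * s) = ((t ^ n : ℝ) : ℂ) ^ s := by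
    intro t n ht
    rw [Complex.cpow_nat_mul', Complex.ofReal_pow]
    all_goals rw [Complex.arg_ofReal_of_nonneg ht.le, mul_zero]
    · linarith [Real.pi_pos]
    · exact Real.pi_pos.le
  rw [Complex.ofReal_mul, Complex.mul_cpow_ofReal_nonneg (by positivity) (by positivity),
    ← e a hx, ← e b hy]

lemma localZeta_modelFun_eq (hq : Even q) (hqa : q ≤ a) {φ : ℝ × ℝ → ℝ} (hφ : ContDiff ℝ ∞ φ)
    (hφc : HasCompactSupport φ) {s : ℂ} (hs : 0 < s.re) :
    localZeta (modelFun a b q p) φ s =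
      quadMellin (reflectSum φ) (a * s) (b * s) + perturbIntegral a b q p (reflectSum φ) s := by
  have hi := integrable_zetaIntegrand a b q p hφ.continuous hφc hs
  have hre : ∀ n : ℕ, -1 < ((n : ℂ) * s).re := fun n => by
    have : (0 : ℝ) ≤ n := n.cast_nonneg
    simp only [Complex.mul_re, Complex.natCast_re, Complex.natCast_im, zero_mul, sub_zero]
    nlinarith
  have i0 := integrable_cpow_mul_cpow_mul hφ.reflectSum.continuous hφc.reflectSum (hre a) (hre b)
  have e1 : localZeta (modelFun a b q p) φ s =
      ∫ z : ℝ × ℝ, ((modelFun a b q p z : ℝ) : ℂ) ^ s * (reflectSum φ z : ℂ) ∂quadMeasure := by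
    rw [localZeta, integral_eq_integral_quadrant hi]
    refine integral_congr_ae ?_
    filter_upwards [ae_quadMeasure] with z hz
    have hz0 : 0 < z.1 ^ a * z.2 ^ b := mul_pos (pow_pos hz.1 _) (pow_pos hz.2 _)
    have h0 : |modelFun a b q p z| = modelFun a b q p z :=
      abs_of_pos (hz0.trans_le (monomial_le_modelFun hz))
    rw [abs_modelFun hqa hq] at h0
    simp only [zetaIntegrand, reflectSum, abs_modelFun hqa hq, abs_neg, flatExp_neg, h0]
    push_cast
    ring
  have i1 : Integrable (fun z : ℝ × ℝ => ((modelFun a b q p z : ℝ) : ℂ) ^ s *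
      (reflectSum φ z : ℂ)) quadMeasure := by
    refine ((integrable_zetaIntegrand a b q p hφ.reflectSum.continuous hφc.reflectSum
      hs).mono_measure quadMeasure_le).congr ?_
    filter_upwards [ae_quadMeasure] with z hz
    have hz0 : 0 < z.1 ^ a * z.2 ^ b := mul_pos (pow_pos hz.1 _) (pow_pos hz.2 _)
    rw [zetaIntegrand, abs_of_pos (hz0.trans_le (monomial_le_modelFun hz))]
  have e2 : quadMellin (reflectSum φ) (a * s) (b * s) =
      ∫ z : ℝ × ℝ, ((z.1 ^ a * z.2 ^ b : ℝ) : ℂ) ^ s * (reflectSum φ z : ℂ) ∂quadMeasure := by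
    refine integral_congr_ae ?_
    filter_upwards [ae_quadMeasure] with z hz
    rw [ofReal_monomial_cpow hz.1 hz.2]
  have i2 : Integrable (fun z : ℝ × ℝ => ((z.1 ^ a * z.2 ^ b : ℝ) : ℂ) ^ s *
      (reflectSum φ z : ℂ)) quadMeasure := by
    refine i0.congr ?_
    filter_upwards [ae_quadMeasure] with z hz
    rw [ofReal_monomial_cpow hz.1 hz.2]
  rw [e1, e2, perturbIntegral, ← integral_add i2]
  · refine integral_congr_ae (Eventually.of_forall fun z => ?_)
    ring
  · simp only [sub_mul]
    exact i1.sub i2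

/-- The meromorphic continuation of `localZeta (modelFun a b q p) φ`. -/
noncomputable def zetaContinuation (a b q : ℕ) (p : ℝ) (φ : ℝ × ℝ → ℝ) (n : ℕ) (s : ℂ) : ℂ :=
  (∏ j ∈ Finset.range n, -(1 / (b * s + (j + 1)))) *
    quadMellin (partialSnd^[n] (reflectSum φ)) (a * s) (b * s + n) +
  perturbIntegral a b q p (reflectSum φ) s

/-- The bound n < b/a places the zeros of bs + j + 1, j < n, among the candidate poles; b/a ≤ n + 1
gives Re(bs) + n > -1 on the half-plane. -/
lemma isZetaContinuation_zetaContinuation (ha : 1 ≤ a) (hb : 1 ≤ b) (hq : Even q) (hq2 : 2 ≤ q)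
    (hqa : q ≤ a) (hp : 0 < p) {φ : ℝ × ℝ → ℝ} (hφ : ContDiff ℝ ∞ φ) (hφc : HasCompactSupport φ)
    {n : ℕ} (hn : (n : ℝ) < (b : ℝ) / a) (hn' : (b : ℝ) / a ≤ n + 1) :
    IsZetaContinuation (modelFun a b q p) φ (-1 / (a : ℝ)) (candidatePoles a b)
      (zetaContinuation a b q p φ n) := by
  have ha' : (0 : ℝ) < a := by exact_mod_cast (by omega : 0 < a)
  have hb' : (0 : ℝ) < b := by exact_mod_cast (by omega : 0 < b)
  have hopen : IsOpen {s : ℂ | -1 / (a : ℝ) < s.re} := isOpen_lt continuous_const Complex.continuous_re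
  have hJ : AnalyticOnNhd ℂ (fun s : ℂ => quadMellin (partialSnd^[n] (reflectSum φ)) (a * s)
      (b * s + n)) {s : ℂ | -1 / (a : ℝ) < s.re} := by
    refine DifferentiableOn.analyticOnNhd (fun s hs => ?_) hopen
    have hs : -1 / (a : ℝ) < s.re := hs
    have h1 : -1 < a * s.re := by rwa [div_lt_iff₀' ha'] at hs
    refine (differentiableAt_quadMellin
      (contDiff_partialSnd_iterate hφ.reflectSum n).continuous
      (hasCompactSupport_partialSnd_iterate hφc.reflectSum n) h1 ?_).differentiableWithinAt
    have h2 : (b : ℝ) / a * -1 < b / a * (a * s.re) := by gcongr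
    have h3 : (b : ℝ) / a * (a * s.re) = b * s.re := by field_simp
    linarith
  have hW : AnalyticOnNhd ℂ (perturbIntegral a b q p (reflectSum φ))
      {s : ℂ | -1 / (a : ℝ) < s.re} :=
    DifferentiableOn.analyticOnNhd (fun s hs => (differentiableAt_perturbIntegral ha hq2 hqa hp
      hφ.reflectSum.continuous hφc.reflectSum hs).differentiableWithinAt) hopen
  refine ⟨fun s hs => integrable_zetaIntegrand a b q p hφ.continuous hφc hs, fun s hs => ?_,
    fun s hs => ?_, fun s hs => ?_⟩
  · have hre : ∀ n : ℕ, -1 < ((n : ℂ) * s).re := fun n => by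
      have : (0 : ℝ) ≤ n := n.cast_nonneg
      simp only [Complex.mul_re, Complex.natCast_re, Complex.natCast_im, zero_mul, sub_zero]
      nlinarith
    rw [localZeta_modelFun_eq hq hqa hφ hφc hs, zetaContinuation,
      quadMellin_eq_partialSnd_iterate hφ.reflectSum hφc.reflectSum (hre a) (hre b) n]
  · refine (MeromorphicAt.mul (MeromorphicAt.fun_prod fun j _ => ?_)
      (hJ s hs).meromorphicAt).add (hW s hs).meromorphicAt
    have : AnalyticAt ℂ (fun s : ℂ => (b : ℂ) * s + (j + 1)) s := by fun_prop
    exact ((MeromorphicAt.const 1 s).div this.meromorphicAt).neg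
  · refine (AnalyticAt.mul (Finset.analyticAt_fun_prod _ fun j hj => ?_) (hJ s hs.1)).add
      (hW s hs.1)
    have : AnalyticAt ℂ (fun s : ℂ => (b : ℂ) * s + (j + 1)) s := by fun_prop
    refine (analyticAt_const.div this fun h0 => hs.2 ?_).neg
    have hj := Finset.mem_range.1 hj
    refine ⟨j + 1, by omega, lt_of_le_of_lt (by exact_mod_cast hj) hn, ?_⟩
    rw [eq_div_iff (by exact_mod_cast hb'.ne')]
    push_cast
    linear_combination h0

lemma zetaContinuation_ofReal (ha : 0 < a) (φ : ℝ × ℝ → ℝ) (n : ℕ) (ε : ℝ) :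
    zetaContinuation a b q p φ n (((ε - 1) / a : ℝ) : ℂ) =
      ((∏ j ∈ Finset.range n, -(1 / (-((b : ℝ) / a) + (b : ℝ) / a * ε + (j + 1))) : ℝ) : ℂ) *
        quadMellin (partialSnd^[n] (reflectSum φ)) ((-1 + ε : ℝ) : ℂ)
          ((-((b : ℝ) / a) + (b : ℝ) / a * ε + n : ℝ) : ℂ) +
      perturbIntegral a b q p (reflectSum φ) (((ε - 1) / a : ℝ) : ℂ) := by
  have ha' : (a : ℂ) ≠ 0 := by exact_mod_cast ha.ne'
  have e1 : (a : ℂ) * (((ε - 1) / a : ℝ) : ℂ) = ((-1 + ε : ℝ) : ℂ) := by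
    push_cast; field_simp; ring
  have e2 : (b : ℂ) * (((ε - 1) / a : ℝ) : ℂ) = ((-((b : ℝ) / a) + (b : ℝ) / a * ε : ℝ) : ℂ) := by
    push_cast; ring
  rw [zetaContinuation, e1, e2]
  push_cast
  rfl

lemma tendsto_prod_neg_inv {β : ℝ} {n : ℕ} (hn : (n : ℝ) < β) :
    Tendsto (fun ε : ℝ => ((∏ j ∈ Finset.range n, -(1 / (-β + β * ε + (j + 1))) : ℝ) : ℂ))
      (𝓝[>] 0) (𝓝 ((∏ j ∈ Finset.range n, -(1 / (-β + (j + 1))) : ℝ) : ℂ)) := by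
  refine (Complex.continuous_ofReal.tendsto _).comp (tendsto_finsetProd _ fun j hj => ?_)
  have hj : ((j + 1 : ℕ) : ℝ) ≤ n := by exact_mod_cast Finset.mem_range.1 hj
  push_cast at hj
  have h : ContinuousAt (fun ε : ℝ => -(1 / (-β + β * ε + (j + 1)))) 0 :=
    (continuousAt_const.div (by fun_prop) (by simp only [mul_zero, add_zero]; linarith)).neg
  have := h.tendsto
  simp only [mul_zero, add_zero] at this
  exact this.mono_left nhdsWithin_le_nhds

/-- When β = n + 1 the factors are 1/(n - j), j < n; reversing their order gives the factorial. -/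
lemma prod_neg_inv_eq (n : ℕ) :
    ∏ j ∈ Finset.range n, -(1 / (-((n : ℝ) + 1) + (j + 1))) = 1 / (n.factorial : ℝ) := by
  rw [← Finset.prod_range_add_one_eq_factorial, ← Finset.prod_range_reflect]
  push_cast
  rw [one_div, ← Finset.prod_inv_distrib]
  refine Finset.prod_congr rfl fun j hj => ?_
  have hj := Finset.mem_range.1 hj
  rw [Nat.cast_sub (by omega), Nat.cast_sub (by omega), ← one_div, ← div_neg]
  congr 1
  push_cast
  ring

lemma tendsto_eps (ha : 0 < a) :
    Tendsto (fun σ : ℝ => a * σ + 1) (𝓝[>] (-1 / (a : ℝ))) (𝓝[>] 0) := by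
  have ha' : (0 : ℝ) < a := by exact_mod_cast ha
  refine tendsto_nhdsWithin_iff.2 ⟨?_, ?_⟩
  · have h : Continuous fun σ : ℝ => a * σ + 1 := by fun_prop
    have := h.tendsto (-1 / (a : ℝ))
    rw [mul_div_cancel₀ _ ha'.ne', neg_add_cancel] at this
    exact this.mono_left nhdsWithin_le_nhds
  · filter_upwards [self_mem_nhdsWithin] with σ hσ
    have hσ : -1 / (a : ℝ) < σ := hσ
    rw [div_lt_iff₀' ha'] at hσ
    show 0 < a * σ + 1
    linarith

/-- Limits at `-1/a` from the right, in terms of the variable `ε = a σ + 1`. -/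
lemma tendsto_of_tendsto_eps (ha : 0 < a) {w : ℝ → ℂ} {F : ℂ → ℂ} {L : ℂ}
    (h : Tendsto (fun ε : ℝ => w ε * F (((ε - 1) / a : ℝ) : ℂ)) (𝓝[>] 0) (𝓝 L)) :
    Tendsto (fun σ : ℝ => w (a * σ + 1) * F (σ : ℂ)) (𝓝[>] (-1 / (a : ℝ))) (𝓝 L) := by
  have ha' : (a : ℝ) ≠ 0 := by exact_mod_cast ha.ne'
  refine (h.comp (tendsto_eps ha)).congr fun σ => ?_
  simp only [Function.comp_apply]
  congr 3
  field_simp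
  ring

lemma tendsto_mul_zetaContinuation (ha : 0 < a) {φ : ℝ × ℝ → ℝ} {n : ℕ}
    (hn : (n : ℝ) < (b : ℝ) / a) {w : ℝ → ℂ} {L₁ L₂ : ℂ}
    (h1 : Tendsto (fun ε : ℝ => w ε * quadMellin (partialSnd^[n] (reflectSum φ))
      ((-1 + ε : ℝ) : ℂ) ((-((b : ℝ) / a) + (b : ℝ) / a * ε + n : ℝ) : ℂ)) (𝓝[>] 0) (𝓝 L₁))
    (h2 : Tendsto (fun ε : ℝ => w ε * perturbIntegral a b q p (reflectSum φ)
      (((ε - 1) / a : ℝ) : ℂ)) (𝓝[>] 0) (𝓝 L₂)) :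
    Tendsto (fun σ : ℝ => w (a * σ + 1) * zetaContinuation a b q p φ n (σ : ℂ))
      (𝓝[>] (-1 / (a : ℝ)))
      (𝓝 (((∏ j ∈ Finset.range n, -(1 / (-((b : ℝ) / a) + (j + 1))) : ℝ) : ℂ) * L₁ + L₂)) := by
  refine tendsto_of_tendsto_eps ha ((((tendsto_prod_neg_inv hn).mul h1).add h2).congr fun ε => ?_)
  rw [zetaContinuation_ofReal ha]
  ring

/-- The monomial part is O(ε^{-2}) in general, and O(ε^{-1}) if β < n + 1, where the y-exponent
stays above -1, or if n is odd, where the derivative vanishes on y = 0 and is bounded by a multiple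
of y. -/
lemma tendsto_rpow_mul_quadMellin_reflectSum_zero {β μ : ℝ} (hβ : 0 < β) (hμ : 1 < μ)
    {φ : ℝ × ℝ → ℝ} (hφ : ContDiff ℝ ∞ φ) (hφc : HasCompactSupport φ) {n : ℕ} (hn' : β ≤ n + 1)
    (h : 2 < μ ∨ β < n + 1 ∨ Odd n) :
    Tendsto (fun ε : ℝ => ((ε ^ μ : ℝ) : ℂ) * quadMellin (partialSnd^[n] (reflectSum φ))
      ((-1 + ε : ℝ) : ℂ) ((-β + β * ε + n : ℝ) : ℂ)) (𝓝[>] 0) (𝓝 0) := by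
  have hg := contDiff_partialSnd_iterate hφ.reflectSum n
  have hc := hasCompactSupport_partialSnd_iterate hφc.reflectSum n
  obtain ⟨R, K, hR, hK0, hK, hs⟩ := exists_bound_support hg.continuous hc
  have hK' : ∀ z : ℝ × ℝ, 0 < z.1 → 0 < z.2 →
      |partialSnd^[n] (reflectSum φ) z| ≤ K * z.2 ^ (0 : ℝ) := fun z _ _ => by
    simpa using hK z
  have hpos : ∀ {η : ℝ}, 0 < η → ∀ ε : ℝ, 0 < ε →
      ε ^ (μ - 1) ≤ 1 / η * ε ^ (μ - 1) * (η + β * ε) := fun {η} hη ε hε => by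
    have h1 := Real.rpow_nonneg hε.le (μ - 1)
    have h2 : 0 ≤ 1 / η * ε ^ (μ - 1) * (β * ε) := by positivity
    have h3 : 1 / η * ε ^ (μ - 1) * η = ε ^ (μ - 1) := by field_simp
    linarith
  rcases h with h | h | h
  · refine (tendsto_rpow_mul_quadMellin_zero (η := n - β + 1) (τ := μ - 2) (A := 1 / β) (μ := μ)
      hR hK' hK0 hs hβ (by linarith) (by linarith) fun ε hε => ?_).congr fun ε => ?_
    · have h1 := Real.rpow_nonneg hε.le (μ - 2)
      have h2 : 0 ≤ 1 / β * ε ^ (μ - 2) * (n - β + 1) :=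
        mul_nonneg (by positivity) (by linarith)
      have h3 : ε ^ (μ - 1) = 1 / β * ε ^ (μ - 2) * (β * ε) := by
        rw [show μ - 1 = μ - 2 + 1 by ring, Real.rpow_add_one hε.ne']; field_simp
      linarith
    · congr 3; ring
  · refine (tendsto_rpow_mul_quadMellin_zero (η := n - β + 1) (τ := μ - 1) (μ := μ)
      hR hK' hK0 hs hβ (by linarith) (by linarith) (hpos (by linarith))).congr fun ε => ?_
    congr 3; ring
  · obtain ⟨C, hC⟩ := hg.lipschitzWith_of_hasCompactSupport hc (by simp)
    have hC' : ∀ z : ℝ × ℝ, 0 < z.1 → 0 < z.2 →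
        |partialSnd^[n] (reflectSum φ) z| ≤ C * z.2 ^ (1 : ℝ) := fun z _ hz => by
      have := hC.dist_le_mul z (z.1, 0)
      rw [partialSnd_iterate_reflectSum_odd hφ h, dist_zero_right] at this
      have hd : dist z (z.1, 0) = z.2 := by
        rw [Prod.dist_eq, dist_self, dist_zero_right, Real.norm_of_nonneg hz.le]
        exact max_eq_right hz.le
      rwa [hd, Real.norm_eq_abs, ← Real.rpow_one z.2] at this
    refine (tendsto_rpow_mul_quadMellin_zero (η := n - β + 2) (τ := μ - 1) (μ := μ)
      hR hC' C.2 hs hβ (by linarith) (by linarith) (hpos (by linarith))).congr fun ε => ?_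
    congr 3; ring

lemma tendsto_sq_mul_quadMellin_reflectSum {β : ℝ} (hβ : 0 < β) {φ : ℝ × ℝ → ℝ}
    (hφ : ContDiff ℝ ∞ φ) (hφc : HasCompactSupport φ) {n : ℕ} (hn : β = n + 1) (he : Even n) :
    Tendsto (fun ε : ℝ => ((ε ^ 2 : ℝ) : ℂ) * quadMellin (partialSnd^[n] (reflectSum φ))
      ((-1 + ε : ℝ) : ℂ) ((-β + β * ε + n : ℝ) : ℂ)) (𝓝[>] 0)
      (𝓝 ((4 * dyOrigin φ n / β : ℝ) : ℂ)) := by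
  rw [← partialSnd_iterate_reflectSum_zero hφ he]
  refine (tendsto_sq_mul_quadMellin (contDiff_partialSnd_iterate hφ.reflectSum n)
    (hasCompactSupport_partialSnd_iterate hφc.reflectSum n) hβ).congr fun ε => ?_
  congr 3
  rw [hn]; ring

end Continuation

/-! ### The theorem. -/

theorem theorem3p1 (a b q : ℕ) (p : ℝ) (ha : 2 ≤ a) (hab : a ≤ b) (hp : 0 < p)
    (hq : Even q) (hq2 : 2 ≤ q) (hqa : q ≤ a)
    (φ : ℝ × ℝ → ℝ) (hφ : ContDiff ℝ ∞ φ) (hφc : HasCompactSupport φ) :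
    (IntegrableOn (integrandC a b q p) (Ioi 0) ∧ 0 < constC a b q p) ∧
    (IntegrableOn (integrandCtilde q p) (Ioi 0) ∧ 0 < constCtilde q p) ∧
    ∃ F : ℂ → ℂ,
      IsZetaContinuation (modelFun a b q p) φ (-1 / (a : ℝ)) (candidatePoles a b) F ∧
      ((p < (b : ℝ) / a - 1 ∨ ¬ IsOddInteger ((b : ℝ) / a)) →
        Tendsto
          (fun σ : ℝ => (((a * σ + 1) ^ (1 + ((b : ℝ) / a - 1) / p) : ℝ) : ℂ) * F (σ : ℂ))
          (𝓝[>] (-1 / (a : ℝ)))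
          (𝓝 ((-4 * p * constC a b q p / (q * ((b : ℝ) / a - 1)) * φ (0, 0) : ℝ) : ℂ))) ∧
      (∀ m : ℕ, p = m → p = (b : ℝ) / a - 1 → IsOddInteger ((b : ℝ) / a) →
        Tendsto
          (fun σ : ℝ => (((a * σ + 1) ^ 2 : ℝ) : ℂ) * F (σ : ℂ))
          (𝓝[>] (-1 / (a : ℝ)))
          (𝓝 ((-4 * constC a b q p / q * φ (0, 0)
            + 4 * a * constCtilde q p / (b * q * ((Nat.factorial (m - 1) : ℕ) : ℝ)) * dyOrigin φ m : ℝ) : ℂ))) ∧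
      (∀ m : ℕ, (m : ℝ) = (b : ℝ) / a - 1 → (b : ℝ) / a - 1 < p → IsOddInteger ((b : ℝ) / a) →
        Tendsto
          (fun σ : ℝ => (((a * σ + 1) ^ 2 : ℝ) : ℂ) * F (σ : ℂ))
          (𝓝[>] (-1 / (a : ℝ)))
          (𝓝 ((4 * a * p * constCtilde q p / (b * q * ((Nat.factorial m : ℕ) : ℝ)) * dyOrigin φ m : ℝ) : ℂ))) := by
  have ha0 : 0 < a := by omega
  have ha1 : 1 ≤ a := ha0
  have hq0 : 0 < q := by omega
  have ha' : (0 : ℝ) < a := by exact_mod_cast ha0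
  have hq' : (0 : ℝ) < q := by exact_mod_cast hq0
  have hb' : (0 : ℝ) < b := by exact_mod_cast (by omega : 0 < b)
  have hβ1 : 1 ≤ (b : ℝ) / a := (one_le_div ha').2 (by exact_mod_cast hab)
  have hβ0 : 0 < (b : ℝ) / a := by linarith
  obtain ⟨n, hn, hn'⟩ : ∃ n : ℕ, (n : ℝ) < (b : ℝ) / a ∧ (b : ℝ) / a ≤ n + 1 := by
    -- Natural-number division: this is ⌈b/a⌉ - 1, so an integral b/a gives n = b/a - 1.
    refine ⟨(b - 1) / a, ?_, ?_⟩
    · rw [lt_div_iff₀ ha']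
      have : (b - 1) / a * a < b := (Nat.div_mul_le_self _ _).trans_lt (by omega)
      exact_mod_cast this
    · rw [div_le_iff₀ ha']
      have := Nat.lt_div_mul_add (a := b - 1) ha0
      have : b ≤ ((b - 1) / a + 1) * a := by rw [add_mul, one_mul]; omega
      exact_mod_cast this
  have hψ0 : reflectSum φ (0, 0) = 4 * φ (0, 0) := by simp [reflectSum]; ring
  have hC := constC_pos (a := a) (b := b) hp hq0 hβ1
  have hCt := constCtilde_eq hp hq0
  have heven : ∀ m : ℕ, (m : ℝ) = (b : ℝ) / a - 1 → IsOddInteger ((b : ℝ) / a) →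
      n = m ∧ Even m := by
    rintro m hm ⟨k, hk, hk'⟩
    have h1 : (m : ℝ) + 1 = k := by rw [← hk']; linarith
    have h2 : (m : ℤ) + 1 = k := by exact_mod_cast h1
    have h3 : n < m + 1 := by
      have : (n : ℝ) < m + 1 := by linarith
      exact_mod_cast this
    have h4 : m ≤ n := by
      have : (m : ℝ) ≤ n := by linarith
      exact_mod_cast this
    refine ⟨by omega, ?_⟩
    rw [← h2] at hk
    have : Even ((m : ℤ)) := by simpa [Int.odd_add] using hk
    exact_mod_cast this
  have hψ := hφ.reflectSum
  have hψc := hφc.reflectSum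
  refine ⟨⟨integrableOn_rpow_mul_exp_neg_inv hp (by linarith) hq', hC⟩,
    ⟨integrableOn_rpow_mul_exp_neg_inv hp (by linarith) hq', by rw [hCt]; positivity⟩,
    zetaContinuation a b q p φ n, isZetaContinuation_zetaContinuation ha1 (by omega) hq hq2 hqa hp
      hφ hφc hn hn', ?_, ?_, ?_⟩
  · intro h
    have hβ : 1 < (b : ℝ) / a := by
      rcases h with h | h
      · linarith
      · refine lt_of_le_of_ne hβ1 fun h1 => h ⟨1, odd_one, ?_⟩
        rw [← h1, Int.cast_one]
    have hμ : 0 < ((b : ℝ) / a - 1) / p := div_pos (by linarith) hp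
    have hJ := tendsto_rpow_mul_quadMellin_reflectSum_zero (β := (b : ℝ) / a)
      -- If p < β - 1 the weight exceeds order 2. Otherwise β is not an odd integer, so β = n + 1
      -- with n even is impossible.
      (μ := 1 + ((b : ℝ) / a - 1) / p) hβ0 (by linarith) hφ hφc hn' (by
        rcases h with h | h
        · left
          have := (one_lt_div hp).2 h
          linarith
        · right
          by_contra hcon
          push Not at hcon
          obtain ⟨h1, h2⟩ := hcon
          rw [Nat.not_odd_iff_even] at h2
          refine h ⟨n + 1, ?_, ?_⟩
          · exact_mod_cast h2.add_one
          · push_cast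
            linarith)
    have hW := tendsto_rpow_mul_perturbIntegral (p := p) ha1 hq2 hqa hp hβ hψ.continuous hψc
    refine (tendsto_mul_zetaContinuation (w := fun ε =>
      ((ε ^ (1 + ((b : ℝ) / a - 1) / p) : ℝ) : ℂ)) ha0 hn hJ hW).trans_eq ?_
    rw [integral_rpow_mul_exp_eq_constC hp hq0 hβ, hψ0, mul_zero, zero_add]
    congr 2
    ring
  · intro m hpm hpβ hodd
    obtain ⟨rfl, he⟩ := heven m (by rw [← hpm, hpβ]) hodd
    have hβn : (b : ℝ) / a = n + 1 := by linarith
    have hβ : 1 < (b : ℝ) / a := by linarith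
    have hJ := tendsto_sq_mul_quadMellin_reflectSum hβ0 hφ hφc hβn he
    have hW := tendsto_rpow_mul_perturbIntegral (p := p) ha1 hq2 hqa hp hβ hψ.continuous hψc
    -- At p = β - 1 both parts have order exactly 2 as far as the weight is concerned, and both
    -- limits contribute.
    have hexp : 1 + ((b : ℝ) / a - 1) / p = (2 : ℕ) := by
      rw [← hpβ, div_self hp.ne']; norm_num
    simp only [hexp, Real.rpow_natCast] at hW
    refine (tendsto_mul_zetaContinuation (w := fun ε => ((ε ^ 2 : ℝ) : ℂ)) ha0 hn hJ hW).trans_eq ?_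
    rw [integral_rpow_mul_exp_eq_constC hp hq0 hβ, hψ0, hCt, ← Complex.ofReal_mul,
      ← Complex.ofReal_add]
    congr 2
    have hprod := prod_neg_inv_eq n
    rw [← hβn] at hprod
    rw [hprod, ← hpβ]
    -- Here n = p > 0, so n - 1 is not truncated, and C̃ = q/p turns 1/n! into the stated 1/(p-1)!.
    obtain ⟨k, rfl⟩ : ∃ k, n = k + 1 := Nat.exists_eq_succ_of_ne_zero (by
      rintro rfl
      simp at hpm
      exact hp.ne' hpm)
    have hk : ((k : ℝ) + 1) = p := by rw [hpm]; push_cast; ring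
    rw [Nat.add_sub_cancel, Nat.factorial_succ]
    push_cast
    rw [hk]
    have := Nat.factorial_ne_zero k
    field_simp
    ring
  · intro m hm hpβ hodd
    obtain ⟨rfl, he⟩ := heven m hm hodd
    have hβn : (b : ℝ) / a = n + 1 := by linarith
    have hJ := tendsto_sq_mul_quadMellin_reflectSum hβ0 hφ hφc hβn he
    have hW := tendsto_sq_mul_perturbIntegral (p := p) ha1 hq2 hqa hp hβ1 hpβ hψ.continuous hψc
    refine (tendsto_mul_zetaContinuation (w := fun ε => ((ε ^ 2 : ℝ) : ℂ)) ha0 hn hJ hW).trans_eq ?_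
    rw [hCt, add_zero, ← Complex.ofReal_mul]
    congr 2
    have hprod := prod_neg_inv_eq n
    rw [← hβn] at hprod
    rw [hprod]
    have := Nat.factorial_ne_zero n
    field_simp
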